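/- Let $m\ge 1$ and $n\ge 0$ be integers. Consider pairs $(a,k)$ where $a$ is a set partition of the $2r$ points $1,\dots,r$ (top row) and $1',\dots,r'$ (bottom row), and $k\in\mathbb{Z}/N\mathbb{Z}$ is a number of internal components counted modulo $N$. They are multiplied by $(a,k)(b,l)=(ab,\,k+l+\Phi(a,b))$: stack $a$ on top of $b$, identifying the bottom points of $a$ with the top points of $b$; the blocks of $ab$ are the traces on the outer top and bottom rows of the connected components of the stacked diagram, and $\Phi(a,b)$ is the number of connected components that contain no point of the outer rows. The $N$-cyclic planar partition monoid $N\mathrm{pPa}_r$ consists of the pairs $(a,k)$ with $a$ planar, that is, with blocks that do not cross when the points are placed around a rectangle in the order $1,\dots,r,r',\dots,1'$; the $N$-cyclic Temperley–Lieb monoid $N\mathrm{TL}_r$ consists of the pairs $(a,k)$ with $a$ planar and all blocks of size two. In $m\mathrm{pPa}_n$ let $c$ be the identity diagram $\{\{j,j'\}\}_{j}$ with one internal component; for $1\le i\le n$ let $p_i$ be the diagram without internal components with blocks $\{i\}$, $\{i'\}$ and $\{j,j'\}$ for $j\ne i$; for $1\le i\le n-1$ let $p_{i+1/2}$ be the diagram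 without internal components with blocks $\{i,i+1,i',(i+1)'\}$ and $\{j,j'\}$ for $j\ne i,i+1$. In $2m\mathrm{TL}_{2n}$ let $o$ be the identity diagram with one internal component, and for $1\le i\le 2n-1$ let $u_i$ be the diagram without internal components with blocks $\{i,i+1\}$, $\{i',(i+1)'\}$ and $\{j,j'\}$ for $j\ne i,i+1$. Then there is an injective monoid homomorphism $f: m\mathrm{pPa}_n\hookrightarrow 2m\mathrm{TL}_{2n}$ with \[ f(p_i)=o\,u_{2i-1}\ (1\le i\le n),\qquad f(p_{i+1/2})=o^{2m-1}u_{2i}\ (1\le i\le n-1),\qquad f(c)=o^2. \] -/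

import Mathlib

namespace CyclicDiagram

/-! ## Gluing partitions

A partition of the points of a diagram with top row `X` and bottom row `Y` is a `Setoid (X ⊕ Y)`;
`Sum.inl` is the top row and `Sum.inr` is the bottom row. -/

section Glue

variable {X Y Z W : Type}

/-- The points of the upper diagram inside the three rows of the stacked diagram. -/
def upperPt : X ⊕ Y → X ⊕ Y ⊕ Z := Sum.map id Sum.inl

/-- The points of the top and bottom row inside the three rows of the stacked diagram. -/
def outerPt : X ⊕ Z → X ⊕ Y ⊕ Z := Sum.map id Sum.inr

/-- Two points of the stacked diagram lie in a common block of one of the two layers. -/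
inductive GlueStep (a : Setoid (X ⊕ Y)) (b : Setoid (Y ⊕ Z)) : X ⊕ Y ⊕ Z → X ⊕ Y ⊕ Z → Prop
  | upper {p q : X ⊕ Y} (h : a.r p q) : GlueStep a b (upperPt p) (upperPt q)
  | lower {p q : Y ⊕ Z} (h : b.r p q) : GlueStep a b (Sum.inr p) (Sum.inr q)

/-- The connected components of the diagram obtained by stacking `a` on top of `b`. -/
def glue (a : Setoid (X ⊕ Y)) (b : Setoid (Y ⊕ Z)) : Setoid (X ⊕ Y ⊕ Z) :=
  Relation.EqvGen.setoid (GlueStep a b)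

/-- The product of two partitions: stack `a` on top of `b` and forget the middle row. -/
def comp (a : Setoid (X ⊕ Y)) (b : Setoid (Y ⊕ Z)) : Setoid (X ⊕ Z) :=
  (glue a b).comap outerPt

/-- The number of internal components created by stacking `a` on top of `b`: the connected
components that contain no point of the top row and no point of the bottom row. -/
noncomputable def internalCount (a : Setoid (X ⊕ Y)) (b : Setoid (Y ⊕ Z)) : ℕ :=
  Nat.card {C : Quotient (glue a b) // ∀ p : X ⊕ Z, C ≠ Quotient.mk (glue a b) (outerPt p)}

/-- The identity partition, with the blocks `{x, x'}`. -/
def idPart (X : Type) : Setoid (X ⊕ X) := Setoid.ker (Sum.elim id id)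

/-! ### Associativity -/

section Pushout

variable {V U O O' P : Type} (i : V → U) (j : O' → U) (e : O → V) (k : O → O')
  (R : V → V → Prop) (S : O' → O' → Prop)

/-- The relation on `U` generated by `R` on `V` and `S` on `O'`. -/
inductive BigStep : U → U → Prop
  | left {v w : V} (h : R v w) : BigStep (i v) (i w)
  | right {v w : O'} (h : S v w) : BigStep (j v) (j w)

/-- The relation on `O'` generated by `S` and by the trace on `O` of the equivalence closure
of `R`. -/
inductive SmallStep : O' → O' → Prop
  | left {v w : O} (h : Relation.EqvGen R (e v) (e w)) : SmallStep (k v) (k w)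
  | right {v w : O'} (h : S v w) : SmallStep v w

/-- `u` is represented by the point `o` of `O'`. -/
def Rep (u : U) (o : O') : Prop :=
  u = j o ∨ ∃ v o₀, u = i v ∧ Relation.EqvGen R v (e o₀) ∧ o = k o₀

variable {i j e k R S}

theorem bigStep_of_eqvGen_left {v w : V} (h : Relation.EqvGen R v w) :
    Relation.EqvGen (BigStep i j R S) (i v) (i w) := by
  induction h with
  | rel _ _ h => exact .rel _ _ (.left h)
  | refl _ => exact .refl _
  | symm _ _ _ ih => exact .symm _ _ ih
  | trans _ _ _ _ _ ih ih' => exact .trans _ _ _ ih ih'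

theorem bigStep_of_smallStep (hij : ∀ o, i (e o) = j (k o)) {v w : O'}
    (h : Relation.EqvGen (SmallStep e k R S) v w) :
    Relation.EqvGen (BigStep i j R S) (j v) (j w) := by
  induction h with
  | rel _ _ h =>
    cases h with
    | left h => rw [← hij, ← hij]; exact bigStep_of_eqvGen_left h
    | right h => exact .rel _ _ (.right h)
  | refl _ => exact .refl _
  | symm _ _ _ ih => exact .symm _ _ ih
  | trans _ _ _ _ _ ih ih' => exact .trans _ _ _ ih ih'

theorem rep_unique (hi : Function.Injective i) (hj : Function.Injective j)
    (hp : ∀ v o', i v = j o' → ∃ o, v = e o ∧ o' = k o)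
    {u : U} {o₁ o₂ : O'} (h₁ : Rep i j e k R u o₁) (h₂ : Rep i j e k R u o₂) :
    Relation.EqvGen (SmallStep e k R S) o₁ o₂ := by
  rcases h₁ with h₁ | ⟨v₁, p₁, h₁, g₁, rfl⟩ <;> rcases h₂ with h₂ | ⟨v₂, p₂, h₂, g₂, rfl⟩
  · rw [hj (h₁.symm.trans h₂)]; exact .refl _
  · obtain ⟨o, rfl, rfl⟩ := hp _ _ (h₂.symm.trans h₁)
    exact .rel _ _ (.left g₂)
  · obtain ⟨o, rfl, rfl⟩ := hp _ _ (h₁.symm.trans h₂)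
    exact .symm _ _ (.rel _ _ (.left g₁))
  · obtain rfl := hi (h₁.symm.trans h₂)
    exact .rel _ _ (.left (.trans _ _ _ (.symm _ _ g₁) g₂))

theorem rep_not_inner (hi : Function.Injective i)
    (hp : ∀ v o', i v = j o' → ∃ o, v = e o ∧ o' = k o)
    {v : V} {o : O'} (h : Rep i j e k R (i v) o) : ∃ o, Relation.EqvGen R v (e o) := by
  rcases h with h | ⟨w, o₀, h, g, -⟩
  · obtain ⟨o, rfl, -⟩ := hp _ _ h
    exact ⟨o, .refl _⟩
  · obtain rfl := hi h
    exact ⟨o₀, g⟩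

theorem bigStep_cases (hi : Function.Injective i) (hj : Function.Injective j)
    (hc : ∀ u, (∃ v, u = i v) ∨ ∃ o, u = j o)
    (hp : ∀ v o', i v = j o' → ∃ o, v = e o ∧ o' = k o)
    {u u' : U} (h : Relation.EqvGen (BigStep i j R S) u u') :
    (∃ v v', u = i v ∧ u' = i v' ∧ Relation.EqvGen R v v' ∧ ∀ o, ¬ Relation.EqvGen R v (e o)) ∨
    ∃ o o', Rep i j e k R u o ∧ Rep i j e k R u' o' ∧
      Relation.EqvGen (SmallStep e k R S) o o' := by
  have hsplit : ∀ v v', Relation.EqvGen R v v' →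
      (∃ w w', i v = i w ∧ i v' = i w' ∧ Relation.EqvGen R w w' ∧
        ∀ o, ¬ Relation.EqvGen R w (e o)) ∨
      ∃ o o', Rep i j e k R (i v) o ∧ Rep i j e k R (i v') o' ∧
        Relation.EqvGen (SmallStep e k R S) o o' := by
    intro v v' h
    by_cases hv : ∃ o, Relation.EqvGen R v (e o)
    · obtain ⟨o, ho⟩ := hv
      exact .inr ⟨k o, k o, .inr ⟨v, o, rfl, ho, rfl⟩,
        .inr ⟨v', o, rfl, .trans _ _ _ (.symm _ _ h) ho, rfl⟩, .refl _⟩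
    · push Not at hv
      exact .inl ⟨v, v', rfl, rfl, h, hv⟩
  induction h with
  | rel _ _ h =>
    cases h with
    | left h => exact hsplit _ _ (.rel _ _ h)
    | right h => exact .inr ⟨_, _, .inl rfl, .inl rfl, .rel _ _ (.right h)⟩
  | refl u =>
    rcases hc u with ⟨v, rfl⟩ | ⟨o, rfl⟩
    · exact hsplit v v (.refl _)
    · exact .inr ⟨o, o, .inl rfl, .inl rfl, .refl _⟩
  | symm _ _ _ ih =>
    rcases ih with ⟨v, v', h, h', g, hv⟩ | ⟨o, o', h, h', g⟩
    · exact .inl ⟨v', v, h', h, .symm _ _ g, fun o ho => hv o (.trans _ _ _ g ho)⟩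
    · exact .inr ⟨o', o, h', h, .symm _ _ g⟩
  | trans _ y _ _ _ ih ih' =>
    rcases ih with ⟨v, v', h, h', g, hv⟩ | ⟨o, o', h, h', g⟩ <;>
      rcases ih' with ⟨w, w', h₂, h₂', g₂, hw⟩ | ⟨p, p', h₂, h₂', g₂⟩
    · obtain rfl := hi (h'.symm.trans h₂)
      exact .inl ⟨v, w', h, h₂', .trans _ _ _ g g₂, hv⟩
    · subst h'
      obtain ⟨o, ho⟩ := rep_not_inner hi hp h₂
      exact (hv o (.trans _ _ _ g ho)).elim
    · subst h₂
      obtain ⟨o, ho⟩ := rep_not_inner hi hp h'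
      exact (hw o ho).elim
    · exact .inr ⟨o, p', h, h₂', .trans _ _ _ g (.trans _ _ _ (rep_unique hi hj hp h' h₂) g₂)⟩

theorem bigStep_iff (hi : Function.Injective i) (hj : Function.Injective j)
    (hc : ∀ u, (∃ v, u = i v) ∨ ∃ o, u = j o)
    (hp : ∀ v o', i v = j o' → ∃ o, v = e o ∧ o' = k o) (hij : ∀ o, i (e o) = j (k o))
    (o o' : O') : Relation.EqvGen (BigStep i j R S) (j o) (j o') ↔
      Relation.EqvGen (SmallStep e k R S) o o' := by
  refine ⟨fun h => ?_, bigStep_of_smallStep hij⟩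
  rcases bigStep_cases hi hj hc hp h with ⟨v, v', h, -, -, hv⟩ | ⟨p, p', h, h', g⟩
  · obtain ⟨q, rfl, -⟩ := hp _ _ h.symm
    exact (hv q (.refl _)).elim
  · exact .trans _ _ _ (rep_unique hi hj hp (.inl rfl) h)
      (.trans _ _ _ g (rep_unique hi hj hp h' (.inl rfl)))

theorem bigStep_card [Finite V] [Finite O'] (w : P → O')
    (hi : Function.Injective i) (hj : Function.Injective j)
    (hc : ∀ u, (∃ v, u = i v) ∨ ∃ o, u = j o)
    (hp : ∀ v o', i v = j o' → ∃ o, v = e o ∧ o' = k o) (hij : ∀ o, i (e o) = j (k o)) :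
    Nat.card {C : Quotient (Relation.EqvGen.setoid (BigStep i j R S)) //
        ∀ p, C ≠ Quotient.mk _ (j (w p))} =
      Nat.card {C : Quotient (Relation.EqvGen.setoid R) // ∀ o, C ≠ Quotient.mk _ (e o)} +
      Nat.card {C : Quotient (Relation.EqvGen.setoid (SmallStep e k R S)) //
        ∀ p, C ≠ Quotient.mk _ (w p)} := by
  classical
  rw [← Nat.card_sum]
  symm
  have key : ∀ (v : V) (o : O'), (∀ o, ¬ Relation.EqvGen R v (e o)) →
      ¬ Relation.EqvGen (BigStep i j R S) (i v) (j o) := by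
    intro v o hv h
    rcases bigStep_cases hi hj hc hp h with ⟨x, x', -, h, g, hx⟩ | ⟨p, p', h, -, -⟩
    · obtain ⟨q, rfl, -⟩ := hp _ _ h.symm
      exact hx q g
    · obtain ⟨o, ho⟩ := rep_not_inner hi hp h
      exact hv o ho
  let F : {C : Quotient (Relation.EqvGen.setoid R) // ∀ o, C ≠ Quotient.mk _ (e o)} ⊕
      {C : Quotient (Relation.EqvGen.setoid (SmallStep e k R S)) //
        ∀ p, C ≠ Quotient.mk _ (w p)} → Quotient (Relation.EqvGen.setoid (BigStep i j R S)) :=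
    Sum.elim
      (fun C => Quotient.map' (s₂ := Relation.EqvGen.setoid (BigStep i j R S)) i
        (fun _ _ h => bigStep_of_eqvGen_left h) C.1)
      (fun C => Quotient.map' (s₂ := Relation.EqvGen.setoid (BigStep i j R S)) j
        (fun _ _ h => bigStep_of_smallStep hij h) C.1)
  have hF : ∀ x, ∀ p, F x ≠ Quotient.mk _ (j (w p)) := by
    rintro (⟨C, hC⟩ | ⟨C, hC⟩) p h
    · induction C using Quotient.inductionOn with | _ v =>
      exact key v (w p) (fun o ho => hC o (Quotient.sound ho)) (Quotient.exact h)
    · induction C using Quotient.inductionOn with | _ v =>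
      exact hC p (Quotient.sound ((bigStep_iff hi hj hc hp hij _ _).1 (Quotient.exact h)))
  refine Nat.card_congr (Equiv.ofBijective (fun x => ⟨F x, hF x⟩) ⟨?_, ?_⟩)
  · intro x y hxy
    have hxy : F x = F y := congrArg Subtype.val hxy
    rcases x with ⟨C, hC⟩ | ⟨C, hC⟩ <;> rcases y with ⟨D, hD⟩ | ⟨D, hD⟩ <;>
      induction C using Quotient.inductionOn with | _ v =>
      induction D using Quotient.inductionOn with | _ v' =>
      have hxy := Quotient.exact hxy
      first
        | exact (key v v' (fun o ho => hC o (Quotient.sound ho)) hxy).elim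
        | exact (key v' v (fun o ho => hD o (Quotient.sound ho)) (.symm _ _ hxy)).elim
        | (have := (bigStep_iff hi hj hc hp hij _ _).1 hxy
           congr 2
           exact Quotient.sound this)
        | (have : Relation.EqvGen R v v' := by
             rcases bigStep_cases hi hj hc hp hxy with ⟨x, x', h, h', g, hx⟩ | ⟨p, p', h, -, -⟩
             · obtain rfl := hi h
               obtain rfl := hi h'
               exact g
             · obtain ⟨o, ho⟩ := rep_not_inner hi hp h
               exact (hC o (Quotient.sound ho)).elim
           congr 2
           exact Quotient.sound this)
  · rintro ⟨C, hC⟩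
    induction C using Quotient.inductionOn with | _ u =>
    have hright : ∀ o, Relation.EqvGen (BigStep i j R S) u (j o) → ∃ x, F x = Quotient.mk _ u := by
      intro o ho
      refine ⟨.inr ⟨Quotient.mk _ o, fun p h => hC p ?_⟩, Quotient.sound (.symm _ _ ho)⟩
      exact Quotient.sound (.trans _ _ _ ho (bigStep_of_smallStep hij (Quotient.exact h)))
    suffices h : ∃ x, F x = Quotient.mk _ u by
      obtain ⟨x, hx⟩ := h
      exact ⟨x, Subtype.ext hx⟩
    rcases hc u with ⟨v, rfl⟩ | ⟨o, rfl⟩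
    · by_cases hv : ∃ o, Relation.EqvGen R v (e o)
      · obtain ⟨o, ho⟩ := hv
        exact hright (k o) (hij o ▸ bigStep_of_eqvGen_left ho)
      · push Not at hv
        exact ⟨.inl ⟨Quotient.mk _ v, fun o h => hv o (Quotient.exact h)⟩, rfl⟩
    · exact hright o (.refl _)

end Pushout

/-- The relation on the four rows of a stack of three diagrams: two points lie in a common block
of one of the three layers. -/
inductive TriStep (a : Setoid (X ⊕ Y)) (b : Setoid (Y ⊕ Z)) (c : Setoid (Z ⊕ W)) :
    X ⊕ Y ⊕ Z ⊕ W → X ⊕ Y ⊕ Z ⊕ W → Prop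
  | first {p q : X ⊕ Y} (h : a.r p q) : TriStep a b c (upperPt p) (upperPt q)
  | second {p q : Y ⊕ Z} (h : b.r p q) : TriStep a b c (.inr (upperPt p)) (.inr (upperPt q))
  | third {p q : Z ⊕ W} (h : c.r p q) : TriStep a b c (.inr (.inr p)) (.inr (.inr q))

/-- The two bottom layers of a stack of two diagrams, as a relation on its three rows. -/
inductive LowerStep (c : Setoid (Z ⊕ W)) : X ⊕ Z ⊕ W → X ⊕ Z ⊕ W → Prop
  | mk {p q : Z ⊕ W} (h : c.r p q) : LowerStep c (.inr p) (.inr q)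

/-- The upper layer of a stack of two diagrams, as a relation on its three rows. -/
inductive UpperStep (a : Setoid (X ⊕ Y)) : X ⊕ Y ⊕ W → X ⊕ Y ⊕ W → Prop
  | mk {p q : X ⊕ Y} (h : a.r p q) : UpperStep a (upperPt p) (upperPt q)

/-- The three top rows of four rows. -/
def topThree : X ⊕ Y ⊕ Z → X ⊕ Y ⊕ Z ⊕ W := Sum.map id (Sum.map id Sum.inl)

theorem triStep_left (a : Setoid (X ⊕ Y)) (b : Setoid (Y ⊕ Z)) (c : Setoid (Z ⊕ W)) :
    TriStep a b c = BigStep topThree outerPt (GlueStep a b) (LowerStep c) := by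
  funext u v
  refine propext ⟨?_, ?_⟩
  · rintro (@⟨p, q, h⟩ | @⟨p, q, h⟩ | @⟨p, q, h⟩)
    · have := BigStep.left (i := topThree) (j := outerPt) (S := LowerStep (X := X) c)
        (GlueStep.upper (b := b) h)
      rcases p with p | p <;> rcases q with q | q <;> exact this
    · have := BigStep.left (i := topThree) (j := outerPt) (S := LowerStep (X := X) c)
        (GlueStep.lower (a := a) h)
      rcases p with p | p <;> rcases q with q | q <;> exact this
    · exact BigStep.right (i := topThree) (j := outerPt) (R := GlueStep a b)
        (LowerStep.mk (X := X) h)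
  · rintro ((@⟨p, q, h⟩ | @⟨p, q, h⟩) | ⟨@⟨p, q, h⟩⟩)
    · have := TriStep.first (b := b) (c := c) h
      rcases p with p | p <;> rcases q with q | q <;> exact this
    · have := TriStep.second (a := a) (c := c) h
      rcases p with p | p <;> rcases q with q | q <;> exact this
    · exact TriStep.third h

theorem triStep_right (a : Setoid (X ⊕ Y)) (b : Setoid (Y ⊕ Z)) (c : Setoid (Z ⊕ W)) :
    TriStep a b c = BigStep Sum.inr (Sum.map id outerPt) (GlueStep b c)
      (UpperStep (W := W) a) := by
  funext u v
  refine propext ⟨?_, ?_⟩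
  · rintro (@⟨p, q, h⟩ | @⟨p, q, h⟩ | @⟨p, q, h⟩)
    · have := BigStep.right (i := Sum.inr) (j := Sum.map id outerPt) (R := GlueStep b c)
        (UpperStep.mk (W := W) h)
      rcases p with p | p <;> rcases q with q | q <;> exact this
    · exact .left (.upper h)
    · exact .left (.lower h)
  · rintro ((@⟨p, q, h⟩ | @⟨p, q, h⟩) | ⟨@⟨p, q, h⟩⟩)
    · exact .second h
    · exact .third h
    · have := TriStep.first (b := b) (c := c) h
      rcases p with p | p <;> rcases q with q | q <;> exact this

theorem glueStep_comp_left (a : Setoid (X ⊕ Y)) (b : Setoid (Y ⊕ Z)) (c : Setoid (Z ⊕ W)) :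
    GlueStep (comp a b) c = SmallStep outerPt upperPt (GlueStep a b) (LowerStep c) := by
  funext u v
  refine propext ⟨?_, ?_⟩
  · rintro (h | h)
    · exact .left h
    · exact .right (.mk h)
  · rintro (h | ⟨⟨h⟩⟩)
    · exact .upper h
    · exact .lower h

theorem glueStep_comp_right (a : Setoid (X ⊕ Y)) (b : Setoid (Y ⊕ Z)) (c : Setoid (Z ⊕ W)) :
    GlueStep a (comp b c) = SmallStep outerPt Sum.inr (GlueStep b c) (UpperStep (W := W) a) := by
  funext u v
  refine propext ⟨?_, ?_⟩
  · rintro (h | h)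
    · exact .right (.mk h)
    · exact .left h
  · rintro (h | ⟨⟨h⟩⟩)
    · exact .lower h
    · exact .upper h

theorem left_pushout_data :
    Function.Injective (topThree : X ⊕ Y ⊕ Z → X ⊕ Y ⊕ Z ⊕ W) ∧
    Function.Injective (outerPt : X ⊕ Z ⊕ W → X ⊕ Y ⊕ Z ⊕ W) ∧
    (∀ u : X ⊕ Y ⊕ Z ⊕ W, (∃ v, u = topThree v) ∨ ∃ o, u = outerPt o) ∧
    (∀ (v : X ⊕ Y ⊕ Z) (o' : X ⊕ Z ⊕ W), topThree v = (outerPt o' : X ⊕ Y ⊕ Z ⊕ W) →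
      ∃ o : X ⊕ Z, v = outerPt o ∧ o' = upperPt o) ∧
    ∀ o : X ⊕ Z, (topThree (outerPt o) : X ⊕ Y ⊕ Z ⊕ W) = outerPt (upperPt o) := by
  refine ⟨?_, ?_, ?_, ?_, ?_⟩
  · rintro (_ | _ | _) (_ | _ | _) h <;> simp_all [topThree]
  · rintro (_ | _ | _) (_ | _ | _) h <;> simp_all [outerPt]
  · rintro (x | y | z | w)
    · exact .inl ⟨.inl x, rfl⟩
    · exact .inl ⟨.inr (.inl y), rfl⟩
    · exact .inl ⟨.inr (.inr z), rfl⟩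
    · exact .inr ⟨.inr (.inr w), rfl⟩
  · rintro (_ | _ | _) (_ | _ | _) h <;> simp_all [topThree, outerPt, upperPt]
  · rintro (_ | _) <;> rfl

theorem right_pushout_data :
    Function.Injective (Sum.inr : Y ⊕ Z ⊕ W → X ⊕ Y ⊕ Z ⊕ W) ∧
    Function.Injective (Sum.map id outerPt : X ⊕ Y ⊕ W → X ⊕ Y ⊕ Z ⊕ W) ∧
    (∀ u : X ⊕ Y ⊕ Z ⊕ W, (∃ v, u = Sum.inr v) ∨ ∃ o : X ⊕ Y ⊕ W, u = Sum.map id outerPt o) ∧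
    (∀ (v : Y ⊕ Z ⊕ W) (o' : X ⊕ Y ⊕ W), Sum.inr v = (Sum.map id outerPt o' : X ⊕ Y ⊕ Z ⊕ W) →
      ∃ o : Y ⊕ W, v = outerPt o ∧ o' = Sum.inr o) ∧
    ∀ o : Y ⊕ W, (Sum.inr (outerPt o) : X ⊕ Y ⊕ Z ⊕ W) = Sum.map id outerPt (Sum.inr o) := by
  refine ⟨Sum.inr_injective, ?_, ?_, ?_, ?_⟩
  · rintro (_ | _ | _) (_ | _ | _) h <;> simp_all [outerPt]
  · rintro (x | v)
    · exact .inr ⟨.inl x, rfl⟩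
    · exact .inl ⟨v, rfl⟩
  · rintro (_ | _ | _) (_ | _ | _) h <;> simp_all [outerPt]
  · rintro (_ | _) <;> rfl

theorem comp_assoc (a : Setoid (X ⊕ Y)) (b : Setoid (Y ⊕ Z)) (c : Setoid (Z ⊕ W)) :
    comp (comp a b) c = comp a (comp b c) := by
  obtain ⟨h₁, h₂, h₃, h₄, h₅⟩ := left_pushout_data (X := X) (Y := Y) (Z := Z) (W := W)
  obtain ⟨g₁, g₂, g₃, g₄, g₅⟩ := right_pushout_data (X := X) (Y := Y) (Z := Z) (W := W)
  refine Setoid.ext fun p q => ?_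
  have hl : (comp (comp a b) c) p q ↔ Relation.EqvGen (TriStep a b c)
      (outerPt (outerPt p)) (outerPt (outerPt q)) := by
    rw [triStep_left, bigStep_iff h₁ h₂ h₃ h₄ h₅, ← glueStep_comp_left]; rfl
  have hr : (comp a (comp b c)) p q ↔ Relation.EqvGen (TriStep a b c)
      (Sum.map id outerPt (outerPt p)) (Sum.map id outerPt (outerPt q)) := by
    rw [triStep_right, bigStep_iff g₁ g₂ g₃ g₄ g₅, ← glueStep_comp_right]; rfl
  have he : ∀ p : X ⊕ W, (outerPt (outerPt p) : X ⊕ Y ⊕ Z ⊕ W) = Sum.map id outerPt (outerPt p) := by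
    rintro (_ | _) <;> rfl
  rw [hl, hr, he, he]

theorem internalCount_assoc [Finite X] [Finite Y] [Finite Z] [Finite W]
    (a : Setoid (X ⊕ Y)) (b : Setoid (Y ⊕ Z)) (c : Setoid (Z ⊕ W)) :
    internalCount a b + internalCount (comp a b) c =
      internalCount b c + internalCount a (comp b c) := by
  obtain ⟨h₁, h₂, h₃, h₄, h₅⟩ := left_pushout_data (X := X) (Y := Y) (Z := Z) (W := W)
  obtain ⟨g₁, g₂, g₃, g₄, g₅⟩ := right_pushout_data (X := X) (Y := Y) (Z := Z) (W := W)
  have hl := bigStep_card (R := GlueStep a b) (S := LowerStep c)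
    (outerPt : X ⊕ W → X ⊕ Z ⊕ W) h₁ h₂ h₃ h₄ h₅
  have hr := bigStep_card (R := GlueStep b c) (S := UpperStep a)
    (outerPt : X ⊕ W → X ⊕ Y ⊕ W) g₁ g₂ g₃ g₄ g₅
  rw [← triStep_left, ← glueStep_comp_left] at hl
  rw [← triStep_right, ← glueStep_comp_right] at hr
  have he : ∀ p : X ⊕ W, (outerPt (outerPt p) : X ⊕ Y ⊕ Z ⊕ W) = Sum.map id outerPt (outerPt p) := by
    rintro (_ | _) <;> rfl
  simp only [he] at hl
  exact hl.symm.trans hr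

/-! ### Identities -/

theorem glue_idPart_left (a : Setoid (X ⊕ Z)) (u v : X ⊕ X ⊕ Z) :
    (glue (idPart X) a) u v ↔ a (Sum.elim Sum.inl id u) (Sum.elim Sum.inl id v) := by
  constructor
  · intro h
    induction h with
    | rel _ _ h =>
      rcases h with @⟨p, q, h⟩ | h
      · have h : Sum.elim id id p = Sum.elim id id q := h
        rcases p with p | p <;> rcases q with q | q <;> obtain rfl : p = q := h <;> exact a.refl _
      · exact h
    | refl _ => exact a.refl _
    | symm _ _ _ ih => exact a.symm ih
    | trans _ _ _ _ _ ih ih' => exact a.trans ih ih'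
  · intro h
    have key : ∀ u : X ⊕ X ⊕ Z, (glue (idPart X) a) u (Sum.inr (Sum.elim Sum.inl id u)) := by
      rintro (x | u)
      · exact .rel _ _ (.upper (p := .inl x) (q := .inr x) rfl)
      · exact .refl _
    exact .trans _ _ _ (key u) (.trans _ _ _ (.rel _ _ (.lower h)) (.symm _ _ (key v)))

theorem glue_idPart_right (a : Setoid (X ⊕ Z)) (u v : X ⊕ Z ⊕ Z) :
    (glue a (idPart Z)) u v ↔
      a (Sum.map id (Sum.elim id id) u) (Sum.map id (Sum.elim id id) v) := by
  constructor
  · intro h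
    induction h with
    | rel _ _ h =>
      rcases h with @⟨p, q, h⟩ | @⟨p, q, h⟩
      · rcases p with p | p <;> rcases q with q | q <;> exact h
      · have h : Sum.elim id id p = Sum.elim id id q := h
        rcases p with p | p <;> rcases q with q | q <;> obtain rfl : p = q := h <;> exact a.refl _
    | refl _ => exact a.refl _
    | symm _ _ _ ih => exact a.symm ih
    | trans _ _ _ _ _ ih ih' => exact a.trans ih ih'
  · intro h
    have key : ∀ u : X ⊕ Z ⊕ Z,
        (glue a (idPart Z)) u (upperPt (Sum.map id (Sum.elim id id) u)) := by
      rintro (x | z | z)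
      · exact .refl _
      · exact .refl _
      · exact .rel _ _ (.lower (p := .inr z) (q := .inl z) rfl)
    exact .trans _ _ _ (key u) (.trans _ _ _ (.rel _ _ (.upper h)) (.symm _ _ (key v)))

theorem idPart_comp (a : Setoid (X ⊕ Z)) : comp (idPart X) a = a := by
  refine Setoid.ext fun p q => (glue_idPart_left a _ _).trans ?_
  rcases p with p | p <;> rcases q with q | q <;> rfl

theorem comp_idPart (a : Setoid (X ⊕ Z)) : comp a (idPart Z) = a := by
  refine Setoid.ext fun p q => (glue_idPart_right a _ _).trans ?_
  rcases p with p | p <;> rcases q with q | q <;> rfl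

theorem internalCount_idPart_left (a : Setoid (X ⊕ Z)) : internalCount (idPart X) a = 0 := by
  have : IsEmpty {C : Quotient (glue (idPart X) a) //
      ∀ p : X ⊕ Z, C ≠ Quotient.mk (glue (idPart X) a) (outerPt p)} := by
    refine ⟨fun ⟨C, hC⟩ => ?_⟩
    induction C using Quotient.inductionOn with | _ u =>
    refine hC (Sum.elim Sum.inl id u) (Quotient.sound ((glue_idPart_left a _ _).2 ?_))
    rcases u with x | x | z <;> exact a.refl _
  exact Nat.card_of_isEmpty

theorem internalCount_idPart_right (a : Setoid (X ⊕ Z)) : internalCount a (idPart Z) = 0 := by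
  have : IsEmpty {C : Quotient (glue a (idPart Z)) //
      ∀ p : X ⊕ Z, C ≠ Quotient.mk (glue a (idPart Z)) (outerPt p)} := by
    refine ⟨fun ⟨C, hC⟩ => ?_⟩
    induction C using Quotient.inductionOn with | _ u =>
    refine hC (Sum.map id (Sum.elim id id) u) (Quotient.sound ((glue_idPart_right a _ _).2 ?_))
    rcases u with x | x | z <;> exact a.refl _
  exact Nat.card_of_isEmpty

end Glue

/-! ## The cyclic partition monoid -/

/-- A partition of the `2n` points `1, …, n` (top row) and `1', …, n'` (bottom row), together with
a number of internal components modulo `m`. The point `i` of a row is the element `i - 1` of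
`Fin n`. -/
@[ext]
structure CyclicPartition (m n : ℕ) where
  /-- the partition of the points -/
  skeleton : Setoid (Fin n ⊕ Fin n)
  /-- the number of internal components modulo `m` -/
  internal : ZMod m

namespace CyclicPartition

variable {m n : ℕ}

/-- Diagrams are multiplied by stacking, the left factor on top; the internal components are those
of the factors and those created by the stacking. -/
noncomputable instance : Monoid (CyclicPartition m n) where
  mul a b := ⟨comp a.skeleton b.skeleton,
    a.internal + b.internal + (internalCount a.skeleton b.skeleton : ZMod m)⟩
  one := ⟨idPart (Fin n), 0⟩
  mul_assoc a b c := by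
    refine CyclicPartition.ext (comp_assoc _ _ _) ?_
    have h := congrArg (Nat.cast : ℕ → ZMod m)
      (internalCount_assoc a.skeleton b.skeleton c.skeleton)
    push_cast at h
    change a.internal + b.internal + (internalCount a.skeleton b.skeleton : ZMod m) + c.internal +
      (internalCount (comp a.skeleton b.skeleton) c.skeleton : ZMod m) = a.internal +
      (b.internal + c.internal + (internalCount b.skeleton c.skeleton : ZMod m)) +
      (internalCount a.skeleton (comp b.skeleton c.skeleton) : ZMod m)
    linear_combination h
  one_mul a := by
    refine CyclicPartition.ext (idPart_comp _) ?_
    change 0 + a.internal + (internalCount (idPart (Fin n)) a.skeleton : ZMod m) = a.internal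
    simp [internalCount_idPart_left]
  mul_one a := by
    refine CyclicPartition.ext (comp_idPart _) ?_
    change a.internal + 0 + (internalCount a.skeleton (idPart (Fin n)) : ZMod m) = a.internal
    simp [internalCount_idPart_right]

end CyclicPartition

/-! ## Planar partitions -/

/-- The position of a point on the boundary of the strip, going around it: `1, …, n` along the top
row and then `n', …, 1'` along the bottom row. -/
def pos {n : ℕ} : Fin n ⊕ Fin n → ℤ
  | .inl i => i.val
  | .inr i => 2 * n - 1 - i.val

/-- A partition is planar if its blocks do not cross. -/
def IsPlanar {n : ℕ} (a : Setoid (Fin n ⊕ Fin n)) : Prop :=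
  ∀ p q r s : Fin n ⊕ Fin n, pos p < pos q → pos q < pos r → pos r < pos s →
    a p r → a q s → a p q

/-- All blocks have size two. -/
def IsMatching {n : ℕ} (a : Setoid (Fin n ⊕ Fin n)) : Prop :=
  ∀ p : Fin n ⊕ Fin n, ∃! q : Fin n ⊕ Fin n, q ≠ p ∧ a p q

section Planar

variable {n : ℕ}

theorem pos_injective : Function.Injective (pos : Fin n ⊕ Fin n → ℤ) := by
  rintro (p | p) (q | q) h <;> simp only [pos] at h
  · congr 1; ext; omega
  · have := p.2; have := q.2; omega
  · have := p.2; have := q.2; omega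
  · congr 1; ext; omega

/-- The number of the points `x`, `z` that come before `r` is even or odd in the same way for all
`r` in one block. -/
theorem IsPlanar.parity {a : Setoid (Fin n ⊕ Fin n)} (ha : IsPlanar a) {x z r s : Fin n ⊕ Fin n}
    (hxz : a x z) (hrs : a r s) (hxr : ¬ a x r) :
    xor (decide (pos x < pos r)) (decide (pos z < pos r)) =
      xor (decide (pos x < pos s)) (decide (pos z < pos s)) := by
  have hne : ∀ u v, a x u → a r v → pos u ≠ pos v := by
    intro u v hu hv h
    obtain rfl := pos_injective h
    exact hxr (a.trans hu (a.symm hv))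
  have aux : ∀ x z r s : Fin n ⊕ Fin n, a x z → a r s → ¬ a x r → pos x ≠ pos r → pos x ≠ pos s →
      pos z ≠ pos r → pos z ≠ pos s → pos x ≤ pos z → pos r ≤ pos s →
      xor (decide (pos x < pos r)) (decide (pos z < pos r)) =
        xor (decide (pos x < pos s)) (decide (pos z < pos s)) := by
    intro x z r s hxz hrs hxr h₁ h₂ h₃ h₄ h₅ h₆
    have c₁ : ¬ (pos x < pos r ∧ pos r < pos z ∧ pos z < pos s) := fun h =>
      hxr (ha _ _ _ _ h.1 h.2.1 h.2.2 hxz hrs)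
    have c₂ : ¬ (pos r < pos x ∧ pos x < pos s ∧ pos s < pos z) := fun h =>
      hxr (a.symm (ha _ _ _ _ h.1 h.2.1 h.2.2 hrs hxz))
    by_cases hxr : pos x < pos r <;> by_cases hzr : pos z < pos r <;>
      by_cases hxs : pos x < pos s <;> by_cases hzs : pos z < pos s <;>
      simp only [hxr, hzr, hxs, hzs] <;> first | rfl | omega
  have n₁ := hne x r (a.refl _) (a.refl _)
  have n₂ := hne x s (a.refl _) hrs
  have n₃ := hne z r hxz (a.refl _)
  have n₄ := hne z s hxz hrs
  have hzr : ¬ a z r := fun h => hxr (a.trans hxz h)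
  have hxs : ¬ a x s := fun h => hxr (a.trans h (a.symm hrs))
  have hzs : ¬ a z s := fun h => hzr (a.trans h (a.symm hrs))
  rcases le_total (pos x) (pos z) with h | h <;> rcases le_total (pos r) (pos s) with h' | h'
  · exact aux x z r s hxz hrs hxr n₁ n₂ n₃ n₄ h h'
  · exact (aux x z s r hxz (a.symm hrs) hxs n₂ n₁ n₄ n₃ h h').symm
  · rw [Bool.xor_comm, aux z x r s (a.symm hxz) hrs hzr n₃ n₄ n₁ n₂ h h', Bool.xor_comm]
  · rw [Bool.xor_comm, ← aux z x s r (a.symm hxz) (a.symm hrs) hzs n₄ n₃ n₂ n₁ h h', Bool.xor_comm]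

theorem isPlanar_of_parity {a : Setoid (Fin n ⊕ Fin n)}
    (ha : ∀ x z r s : Fin n ⊕ Fin n, a x z → a r s → ¬ a x r →
      xor (decide (pos x < pos r)) (decide (pos z < pos r)) =
        xor (decide (pos x < pos s)) (decide (pos z < pos s))) : IsPlanar a := by
  intro p q r s h₁ h₂ h₃ hpr hqs
  by_contra h
  have := ha p r q s hpr hqs h
  have e₁ : ¬ pos r < pos q := by omega
  have e₂ : pos p < pos s := by omega
  simp [h₁, h₃, e₁, e₂] at this

theorem IsPlanar.parity' {a : Setoid (Fin n ⊕ Fin n)} (ha : IsPlanar a) {x z r s : Fin n ⊕ Fin n}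
    (hxz : a x z) (hrs : a r s) (hxr : ¬ a x r) :
    xor (decide (pos r < pos x)) (decide (pos r < pos z)) =
      xor (decide (pos s < pos x)) (decide (pos s < pos z)) := by
  have hne : ∀ u v, a x u → a r v → decide (pos v < pos u) = !decide (pos u < pos v) := by
    intro u v hu hv
    have h : pos u ≠ pos v := by
      intro h
      obtain rfl := pos_injective h
      exact hxr (a.trans hu (a.symm hv))
    rw [← decide_not, decide_eq_decide]
    omega
  rw [hne x r (a.refl _) (a.refl _), hne x s (a.refl _) hrs, hne z r hxz (a.refl _),
    hne z s hxz hrs, Bool.not_xor_not, Bool.not_xor_not]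
  exact ha.parity hxz hrs hxr

/-- The position of a point relative to a point of the top row. -/
def topMark (r : Fin n) : Fin n ⊕ Fin n ⊕ Fin n → Bool
  | .inl t => decide (t < r)
  | _ => false

/-- The position of a point relative to a point of the middle row. -/
def middleMark (r : Fin n) : Fin n ⊕ Fin n ⊕ Fin n → Bool
  | .inr (.inl y) => decide (r < y)
  | _ => true

/-- The position of a point relative to a point of the bottom row. -/
def bottomMark (r : Fin n) : Fin n ⊕ Fin n ⊕ Fin n → Bool
  | .inr (.inr t) => decide (t < r)
  | _ => false

theorem upper_marks (p : Fin n ⊕ Fin n) (r : Fin n) :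
    decide (pos p < pos (.inl r)) = topMark r (upperPt p) ∧
    decide (pos p < pos (.inr r)) = middleMark r (upperPt p) ∧
    bottomMark r (upperPt p) = false := by
  rcases p with p | p <;> have := p.2 <;> have := r.2
  · refine ⟨?_, ?_, rfl⟩
    · change decide ((p : ℤ) < r) = decide (p.val < r.val)
      rw [decide_eq_decide]; omega
    · change decide ((p : ℤ) < 2 * n - 1 - r) = true
      rw [decide_eq_true_eq]; omega
  · refine ⟨?_, ?_, rfl⟩
    · change decide (2 * (n : ℤ) - 1 - p < r) = false
      rw [decide_eq_false_iff_not]; omega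
    · change decide (2 * (n : ℤ) - 1 - p < 2 * (n : ℤ) - 1 - r) = decide (r.val < p.val)
      rw [decide_eq_decide]; omega

theorem lower_marks (p : Fin n ⊕ Fin n) (r : Fin n) :
    topMark r (.inr p) = false ∧
    decide (pos (.inl r) < pos p) = middleMark r (.inr p) ∧
    decide (pos (.inr r) < pos p) = bottomMark r (.inr p) := by
  rcases p with p | p <;> have := p.2 <;> have := r.2
  · refine ⟨rfl, ?_, ?_⟩
    · change decide ((r : ℤ) < p) = decide (r.val < p.val)
      rw [decide_eq_decide]; omega
    · change decide (2 * (n : ℤ) - 1 - r < p) = false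
      rw [decide_eq_false_iff_not]; omega
  · refine ⟨rfl, ?_, ?_⟩
    · change decide ((r : ℤ) < 2 * n - 1 - p) = true
      rw [decide_eq_true_eq]; omega
    · change decide (2 * (n : ℤ) - 1 - r < 2 * (n : ℤ) - 1 - p) = decide (p.val < r.val)
      rw [decide_eq_decide]; omega

theorem glue_parity {a b : Setoid (Fin n ⊕ Fin n)} (ha : IsPlanar a) (hb : IsPlanar b)
    {x z : Fin n ⊕ Fin n ⊕ Fin n} (h : (glue a b) x z) :
    ∃ F G : Fin n ⊕ Fin n → Bool,
      (∀ r s, a r s → ¬ (glue a b) x (upperPt r) → F r = F s) ∧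
      (∀ r s, b r s → ¬ (glue a b) x (Sum.inr r) → G r = G s) ∧
      ∀ r : Fin n, F (.inl r) = xor (topMark r x) (topMark r z) ∧
        G (.inr r) = xor (bottomMark r x) (bottomMark r z) ∧
        xor (F (.inr r)) (G (.inl r)) = xor (middleMark r x) (middleMark r z) := by
  induction h with
  | rel x z h =>
    rcases h with @⟨p, q, h⟩ | @⟨p, q, h⟩
    · refine ⟨fun r => xor (decide (pos p < pos r)) (decide (pos q < pos r)), fun _ => false,
        fun r s hrs hr => ha.parity h hrs fun hpr => hr (.rel _ _ (.upper hpr)),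
        fun _ _ _ _ => rfl, fun r => ?_⟩
      obtain ⟨h₁, h₂, h₃⟩ := upper_marks p r
      obtain ⟨h₄, h₅, h₆⟩ := upper_marks q r
      simp only [h₁, h₂, h₃, h₄, h₅, h₆, Bool.xor_false, and_self]
    · refine ⟨fun _ => false, fun r => xor (decide (pos r < pos p)) (decide (pos r < pos q)),
        fun _ _ _ _ => rfl,
        fun r s hrs hr => hb.parity' h hrs fun hpr => hr (.rel _ _ (.lower hpr)), fun r => ?_⟩
      obtain ⟨h₁, h₂, h₃⟩ := lower_marks p r
      obtain ⟨h₄, h₅, h₆⟩ := lower_marks q r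
      simp only [h₁, h₂, h₃, h₄, h₅, h₆, Bool.xor_false, Bool.false_xor, and_self]
  | refl x => exact ⟨fun _ => false, fun _ => false, by simp⟩
  | symm x z h ih =>
    obtain ⟨F, G, h₁, h₂, h₃⟩ := ih
    refine ⟨F, G, fun r s hrs hr => h₁ r s hrs fun h' => hr (.trans _ _ _ (.symm _ _ h) h'),
      fun r s hrs hr => h₂ r s hrs fun h' => hr (.trans _ _ _ (.symm _ _ h) h'), fun r => ?_⟩
    rw [Bool.xor_comm (topMark r z), Bool.xor_comm (bottomMark r z),
      Bool.xor_comm (middleMark r z)]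
    exact h₃ r
  | trans x y z h h' ih ih' =>
    obtain ⟨F, G, h₁, h₂, h₃⟩ := ih
    obtain ⟨F', G', h₁', h₂', h₃'⟩ := ih'
    refine ⟨fun r => xor (F r) (F' r), fun r => xor (G r) (G' r), ?_, ?_, fun r => ?_⟩
    · intro r s hrs hr
      exact congrArg₂ _ (h₁ r s hrs hr) (h₁' r s hrs fun h'' => hr (.trans _ _ _ h h''))
    · intro r s hrs hr
      exact congrArg₂ _ (h₂ r s hrs hr) (h₂' r s hrs fun h'' => hr (.trans _ _ _ h h''))
    · obtain ⟨e₁, e₂, e₃⟩ := h₃ r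
      obtain ⟨e₁', e₂', e₃'⟩ := h₃' r
      have key : ∀ A B C : Bool, xor (xor A B) (xor B C) = xor A C := by decide
      have key' : ∀ A B C D : Bool, xor (xor A B) (xor C D) = xor (xor A C) (xor B D) := by decide
      refine ⟨?_, ?_, ?_⟩
      · simp only [e₁, e₁', key]
      · simp only [e₂, e₂', key]
      · rw [← key (middleMark r x) (middleMark r y), ← e₃, ← e₃']
        exact key' _ _ _ _

theorem outer_marks (x r : Fin n ⊕ Fin n) (h : x ≠ r) :
    decide (pos x < pos r) = r.elim (fun t => topMark t (outerPt x))
      (fun t => !bottomMark t (outerPt x)) := by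
  have h' : ∀ u v : Fin n, u ≠ v → u.val ≠ v.val := fun _ _ h h' => h (Fin.ext h')
  rcases x with x | x <;> rcases r with r | r <;> have := x.2 <;> have := r.2
  · simp [pos, outerPt, topMark]
  · change decide ((x : ℤ) < 2 * n - 1 - r) = true
    rw [decide_eq_true_eq]; omega
  · change decide (2 * (n : ℤ) - 1 - x < r) = false
    rw [decide_eq_false_iff_not]; omega
  · have := h' x r fun h' => h (congrArg _ h')
    change decide (2 * (n : ℤ) - 1 - x < 2 * (n : ℤ) - 1 - r) = !decide (x.val < r.val)
    rw [← decide_not, decide_eq_decide]; omega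

/-- Stacking planar partitions gives a planar partition. -/
theorem IsPlanar.comp {a b : Setoid (Fin n ⊕ Fin n)} (ha : IsPlanar a) (hb : IsPlanar b) :
    IsPlanar (comp a b) := by
  refine isPlanar_of_parity fun x z r s hxz hrs hxr => ?_
  obtain ⟨F, G, h₁, h₂, h₃⟩ := glue_parity ha hb hxz
  have hmid : ∀ x : Fin n ⊕ Fin n, ∀ t, middleMark t (outerPt x) = true := by
    rintro (x | x) t <;> rfl
  let H : Fin n ⊕ Fin n ⊕ Fin n → Bool := Sum.elim (fun t => F (.inl t)) G
  have hup : ∀ p, H (upperPt p) = F p := by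
    rintro (t | t)
    · rfl
    · have := (h₃ t).2.2
      rw [hmid, hmid, Bool.xor_self] at this
      exact (bne_eq_false_iff_eq.1 this).symm
  have hH : ∀ u v, (glue a b) u v → ¬ (glue a b) (outerPt x) u → H u = H v := by
    intro u v huv
    induction huv with
    | rel _ _ h =>
      intro hu
      rcases h with h | h
      · rw [hup, hup]; exact h₁ _ _ h hu
      · exact h₂ _ _ h hu
    | refl _ => exact fun _ => rfl
    | symm _ _ h ih => exact fun hu => (ih fun h' => hu (.trans _ _ _ h' h)).symm
    | trans _ _ _ h h' ih ih' =>
      exact fun hu => (ih hu).trans (ih' fun h'' => hu (.trans _ _ _ h'' (.symm _ _ h)))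
  have hval : ∀ r, (CyclicDiagram.comp a b) x z → ¬ (CyclicDiagram.comp a b) x r →
      xor (decide (pos x < pos r)) (decide (pos z < pos r)) = H (outerPt r) := by
    intro r hxz hxr
    rw [outer_marks x r, outer_marks z r]
    · rcases r with r | r
      · exact (h₃ r).1.symm
      · simp only [Sum.elim_inr, Bool.not_xor_not]
        exact (h₃ r).2.1.symm
    · rintro rfl; exact hxr hxz
    · rintro rfl; exact hxr (Setoid.refl' _ _)
  rw [hval r hxz hxr, hval s hxz fun h => hxr (Setoid.trans' _ h (Setoid.symm' _ hrs))]
  exact hH _ _ hrs hxr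

end Planar

/-! ## Matchings -/

section Matching

/-- In a graph in which every vertex has at most one `α`-edge and at most one `β`-edge and which has
no isolated vertices, each end of a path has exactly one other end in its component. -/
theorem exists_unique_end {V : Type} [Finite V] (α β : V → V) (hα : ∀ v, α (α v) = v)
    (hβ : ∀ v, β (β v) = v) (hαβ : ∀ v, ¬ (α v = v ∧ β v = v)) (x : V) (hx : β x = x) :
    ∃! y, y ≠ x ∧ (α y = y ∨ β y = y) ∧
      Relation.EqvGen (fun u v => v = α u ∨ v = β u) x y := by
  let A : Equiv.Perm V := ⟨α, α, hα, hα⟩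
  let B : Equiv.Perm V := ⟨β, β, hβ, hβ⟩
  let ρ : Equiv.Perm V := A * B
  have hρ : B * ρ * B⁻¹ = ρ⁻¹ := by
    have hB : B⁻¹ = B := rfl
    have hA : A⁻¹ = A := rfl
    simp only [ρ, mul_inv_rev, hA, mul_assoc, mul_inv_cancel, mul_one]
    rw [hB]
  have hBk : ∀ k : ℤ, β ((ρ ^ k) x) = (ρ ^ (-k)) x := by
    intro k
    have h : B * ρ ^ k * B⁻¹ = ρ ^ (-k) := by rw [← conj_zpow, hρ, inv_zpow, zpow_neg]
    have h' : B⁻¹ x = x := hx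
    calc β ((ρ ^ k) x) = (B * ρ ^ k * B⁻¹) x := by rw [Equiv.Perm.mul_apply, h']; rfl
      _ = _ := by rw [h]
  have hAk : ∀ k : ℤ, α ((ρ ^ k) x) = (ρ ^ (1 - k)) x := by
    intro k
    have h : α ((ρ ^ k) x) = ρ (β ((ρ ^ k) x)) := by
      change _ = α (β (β ((ρ ^ k) x)))
      rw [hβ]
    rw [h, hBk, sub_eq_add_neg, zpow_add, zpow_one]; rfl
  have horb : ∀ y, Relation.EqvGen (fun u v => v = α u ∨ v = β u) x y → ∃ k : ℤ, y = (ρ ^ k) x := by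
    suffices h : ∀ u v, Relation.EqvGen (fun u v => v = α u ∨ v = β u) u v →
        ((∃ k : ℤ, u = (ρ ^ k) x) ↔ ∃ k : ℤ, v = (ρ ^ k) x) from
      fun y hy => (h x y hy).1 ⟨0, rfl⟩
    intro u v huv
    induction huv with
    | rel u v h =>
      rcases h with rfl | rfl
      · exact ⟨fun ⟨k, hk⟩ => ⟨1 - k, by rw [hk, hAk]⟩,
          fun ⟨k, hk⟩ => ⟨1 - k, by rw [← hAk, ← hk, hα]⟩⟩
      · exact ⟨fun ⟨k, hk⟩ => ⟨-k, by rw [hk, hBk]⟩, fun ⟨k, hk⟩ => ⟨-k, by rw [← hBk, ← hk, hβ]⟩⟩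
    | refl _ => exact Iff.rfl
    | symm _ _ _ ih => exact ih.symm
    | trans _ _ _ _ _ ih ih' => exact ih.trans ih'
  have hmem : ∀ k : ℤ, Relation.EqvGen (fun u v => v = α u ∨ v = β u) x ((ρ ^ k) x) := by
    have hstep : ∀ y, Relation.EqvGen (fun u v => v = α u ∨ v = β u) y (ρ y) := fun y =>
      .trans _ _ _ (.rel _ (β y) (.inr rfl)) (.rel _ _ (.inl rfl))
    intro k
    induction k with
    | zero => exact .refl _
    | succ k ih =>
      rw [add_comm, zpow_add, zpow_one]
      exact .trans _ _ _ ih (hstep _)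
    | pred k ih =>
      refine .trans _ _ _ ih (.symm _ _ ?_)
      have h : (ρ ^ (-(k : ℤ))) x = ρ ((ρ ^ (-(k : ℤ) - 1)) x) := by
        rw [← Equiv.Perm.mul_apply, ← zpow_one_add]; congr 2; omega
      rw [h]
      exact hstep _
  obtain ⟨N, hN, hper⟩ : ∃ N : ℕ, 0 < N ∧ ∀ k : ℤ, (ρ ^ k) x = x ↔ (N : ℤ) ∣ k := by
    refine ⟨Function.minimalPeriod (ρ • ·) x, ?_, fun k =>
      MulAction.zpow_smul_eq_iff_minimalPeriod_dvd (a := ρ) (b := x) (n := k)⟩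
    obtain ⟨m, hm, hm'⟩ := isOfFinOrder_iff_pow_eq_one.1 (isOfFinOrder_of_finite ρ)
    refine Function.IsPeriodicPt.minimalPeriod_pos hm ?_
    have h : (fun y => ρ • y) = ρ := rfl
    rw [h, Function.IsPeriodicPt, Function.IsFixedPt, ← Equiv.Perm.coe_pow, hm']; rfl
  have heq : ∀ k l : ℤ, (ρ ^ k) x = (ρ ^ l) x ↔ (N : ℤ) ∣ k - l := by
    intro k l
    rw [← hper, sub_eq_neg_add, zpow_add, Equiv.Perm.mul_apply, zpow_neg, Equiv.Perm.inv_eq_iff_eq,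
      eq_comm]
  have hend : ∀ k : ℤ, (α ((ρ ^ k) x) = (ρ ^ k) x ∨ β ((ρ ^ k) x) = (ρ ^ k) x) ↔
      ((N : ℤ) ∣ 2 * k - 1 ∨ (N : ℤ) ∣ 2 * k) := by
    intro k
    rw [hAk, hBk, heq, heq, ← dvd_neg, ← dvd_neg (b := -k - k)]
    ring_nf
  have hN1 : N ≠ 1 := by
    rintro rfl
    have h := (hper 1).2 (by simp)
    have h' : α (β x) = x := h
    rw [hx] at h'
    exact hαβ x ⟨h', hx⟩
  have hne : ∀ k : ℤ, (ρ ^ k) x ≠ x ↔ ¬ (N : ℤ) ∣ k := fun k => not_congr (hper k)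
  have main : ∀ k₀ : ℤ, ¬ (N : ℤ) ∣ k₀ → ((N : ℤ) ∣ 2 * k₀ - 1 ∨ (N : ℤ) ∣ 2 * k₀) →
      (∀ k : ℤ, ¬ (N : ℤ) ∣ k → ((N : ℤ) ∣ 2 * k - 1 ∨ (N : ℤ) ∣ 2 * k) → (N : ℤ) ∣ k - k₀) →
      ∃! y, y ≠ x ∧ (α y = y ∨ β y = y) ∧
        Relation.EqvGen (fun u v => v = α u ∨ v = β u) x y := by
    intro k₀ h₁ h₂ h₃
    refine ⟨(ρ ^ k₀) x, ⟨(hne _).2 h₁, (hend _).2 h₂, hmem _⟩, ?_⟩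
    rintro y ⟨hy₁, hy₂, hy₃⟩
    obtain ⟨k, rfl⟩ := horb y hy₃
    exact (heq _ _).2 (h₃ k ((hne _).1 hy₁) ((hend _).1 hy₂))
  rcases Nat.even_or_odd' N with ⟨M, rfl | rfl⟩
  · refine main M ?_ (.inr (by push_cast; exact dvd_rfl)) ?_
    · rintro ⟨t, ht⟩
      push_cast at ht
      have hM : (M : ℤ) ≠ 0 := by omega
      have : (1 : ℤ) = 2 * t := mul_left_cancel₀ hM (by linarith)
      omega
    · rintro k hk (⟨t, ht⟩ | ⟨t, ht⟩)
      · push_cast at ht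
        have : 2 * k - 1 = 2 * (M * t) := by linarith
        omega
      · push_cast at ht
        have h : k = M * t := by linarith
        rcases Int.even_or_odd' t with ⟨u, rfl | rfl⟩
        · exact (hk ⟨u, by push_cast; linarith⟩).elim
        · exact ⟨u, by push_cast; linarith⟩
  · have hcop : IsCoprime ((2 * M + 1 : ℕ) : ℤ) 2 := ⟨1, -M, by push_cast; ring⟩
    refine main (M + 1) ?_ (.inl ⟨1, by push_cast; ring⟩) ?_
    · rintro ⟨t, ht⟩
      push_cast at ht
      have hM : 0 < (M : ℤ) := by omega
      rcases le_or_gt t 0 with h | h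
      · nlinarith
      · nlinarith
    · rintro k hk (⟨t, ht⟩ | h)
      · refine hcop.dvd_of_dvd_mul_left ⟨t - 1, ?_⟩
        push_cast at ht ⊢
        linarith
      · exact (hk (hcop.dvd_of_dvd_mul_left h)).elim

/-- Stacking matchings gives a matching. -/
theorem IsMatching.comp {n : ℕ} {a b : Setoid (Fin n ⊕ Fin n)} (ha : IsMatching a)
    (hb : IsMatching b) : IsMatching (comp a b) := by
  choose f hf hf' using ha
  choose g hg hg' using hb
  have hff : ∀ p, f (f p) = p := fun p => (hf' _ _ ⟨(hf p).1.symm, a.symm (hf p).2⟩).symm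
  have hgg : ∀ p, g (g p) = p := fun p => (hg' _ _ ⟨(hg p).1.symm, b.symm (hg p).2⟩).symm
  let α : Fin n ⊕ Fin n ⊕ Fin n → Fin n ⊕ Fin n ⊕ Fin n
    | .inl x => upperPt (f (.inl x))
    | .inr (.inl y) => upperPt (f (.inr y))
    | .inr (.inr z) => .inr (.inr z)
  let β : Fin n ⊕ Fin n ⊕ Fin n → Fin n ⊕ Fin n ⊕ Fin n
    | .inl x => .inl x
    | .inr p => .inr (g p)
  have hup : ∀ p, α (upperPt p) = upperPt (f p) := by rintro (p | p) <;> rfl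
  have hupi : Function.Injective (upperPt : Fin n ⊕ Fin n → Fin n ⊕ Fin n ⊕ Fin n) :=
    Function.injective_id.sumMap Sum.inl_injective
  have hαα : ∀ v, α (α v) = v := by
    rintro (x | y | z)
    · change α (upperPt _) = _; rw [hup, hff]; rfl
    · change α (upperPt _) = _; rw [hup, hff]; rfl
    · rfl
  have hββ : ∀ v, β (β v) = v := by
    rintro (x | p)
    · rfl
    · exact congrArg Sum.inr (hgg p)
  have hαfix : ∀ v, α v = v ↔ ∃ z, v = .inr (.inr z) := by
    rintro (x | y | z)
    · refine ⟨fun h => ((hf (.inl x)).1 (hupi h)).elim, by simp⟩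
    · refine ⟨fun h => ((hf (.inr y)).1 (hupi h)).elim, by simp⟩
    · exact ⟨fun _ => ⟨z, rfl⟩, fun _ => rfl⟩
  have hβfix : ∀ v, β v = v ↔ ∃ z, v = .inl z := by
    rintro (x | p)
    · exact ⟨fun _ => ⟨x, rfl⟩, fun _ => rfl⟩
    · exact ⟨fun h => ((hg p).1 (Sum.inr_injective h)).elim, by simp⟩
  have hglue : ∀ u v, (glue a b) u v ↔ Relation.EqvGen (fun u v => v = α u ∨ v = β u) u v := by
    intro u v
    constructor <;> intro h
    · induction h with
      | rel _ _ h =>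
        rcases h with @⟨p, q, h⟩ | @⟨p, q, h⟩
        · by_cases hpq : q = p
          · subst hpq; exact .refl _
          · rw [hf' p q ⟨hpq, h⟩]
            exact .rel _ _ (.inl (hup p).symm)
        · by_cases hpq : q = p
          · subst hpq; exact .refl _
          · rw [hg' p q ⟨hpq, h⟩]
            exact .rel _ _ (.inr rfl)
      | refl _ => exact .refl _
      | symm _ _ _ ih => exact .symm _ _ ih
      | trans _ _ _ _ _ ih ih' => exact .trans _ _ _ ih ih'
    · induction h with
      | rel u v h =>
        rcases h with rfl | rfl
        · rcases u with x | y | z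
          · exact .rel _ _ (.upper (p := .inl x) (hf _).2)
          · exact .rel _ _ (.upper (p := .inr y) (hf _).2)
          · exact .refl _
        · rcases u with x | p
          · exact .refl _
          · exact .rel _ _ (.lower (hg _).2)
      | refl _ => exact .refl _
      | symm _ _ _ ih => exact .symm _ _ ih
      | trans _ _ _ _ _ ih ih' => exact .trans _ _ _ ih ih'
  have hαβ : ∀ v, ¬ (α v = v ∧ β v = v) := by
    rintro v ⟨h, h'⟩
    obtain ⟨z, rfl⟩ := (hαfix _).1 h
    obtain ⟨y, hy⟩ := (hβfix (.inr (.inr z))).1 h'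
    exact absurd hy (by simp)
  have houter : ∀ v, (α v = v ∨ β v = v) ↔ ∃ q, v = outerPt q := by
    intro v
    rw [hαfix, hβfix]
    constructor
    · rintro (⟨z, rfl⟩ | ⟨z, rfl⟩)
      · exact ⟨.inr z, rfl⟩
      · exact ⟨.inl z, rfl⟩
    · rintro ⟨z | z, rfl⟩
      · exact .inr ⟨z, rfl⟩
      · exact .inl ⟨z, rfl⟩
  have hout : Function.Injective (outerPt : Fin n ⊕ Fin n → Fin n ⊕ Fin n ⊕ Fin n) :=
    Function.injective_id.sumMap Sum.inr_injective
  have hend : ∀ p : Fin n ⊕ Fin n, ∃! y, y ≠ outerPt p ∧ (α y = y ∨ β y = y) ∧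
      Relation.EqvGen (fun u v => v = α u ∨ v = β u) (outerPt p) y := by
    rintro (x | z)
    · exact exists_unique_end α β hαα hββ hαβ _ rfl
    · have h := exists_unique_end β α hββ hαα (fun v h => hαβ v h.symm) (outerPt (.inr z)) rfl
      simpa only [or_comm] using h
  intro p
  obtain ⟨y, ⟨h₁, h₂, h₃⟩, h₄⟩ := hend p
  obtain ⟨q, rfl⟩ := (houter y).1 h₂
  refine ⟨q, ⟨fun h => h₁ (congrArg _ h), (hglue _ _).2 h₃⟩, ?_⟩
  rintro r ⟨hr, hr'⟩
  exact hout (h₄ _ ⟨fun h => hr (hout h), (houter _).2 ⟨r, rfl⟩, (hglue _ _).1 hr'⟩)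

end Matching

/-! ## The generating diagrams -/

section Generators

variable {n : ℕ}

/-- The partition with singleton blocks `{i}` and `{i'}` and blocks `{j, j'}` for `j ≠ i`. -/
def stopPart (n i : ℕ) : Setoid (Fin n ⊕ Fin n) :=
  Setoid.ker (Sum.elim
    (fun j : Fin n => if j.val + 1 = i then (Sum.inr true : Fin n ⊕ Bool) else Sum.inl j)
    (fun j : Fin n => if j.val + 1 = i then (Sum.inr false : Fin n ⊕ Bool) else Sum.inl j))

/-- The partition with the block `{i, i+1, i', (i+1)'}` and blocks `{j, j'}` for the other `j`. -/
def bridgePart (n i : ℕ) : Setoid (Fin n ⊕ Fin n) :=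
  Setoid.ker (Sum.elim
    (fun j : Fin n => if j.val + 1 = i ∨ j.val + 1 = i + 1 then (Sum.inr true : Fin n ⊕ Bool)
      else Sum.inl j)
    (fun j : Fin n => if j.val + 1 = i ∨ j.val + 1 = i + 1 then (Sum.inr true : Fin n ⊕ Bool)
      else Sum.inl j))

/-- The partition with blocks `{i, i+1}`, `{i', (i+1)'}` and `{j, j'}` for the other `j`. -/
def hookPart (n i : ℕ) : Setoid (Fin n ⊕ Fin n) :=
  Setoid.ker (Sum.elim
    (fun j : Fin n => if j.val + 1 = i ∨ j.val + 1 = i + 1 then (Sum.inr true : Fin n ⊕ Bool)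
      else Sum.inl j)
    (fun j : Fin n => if j.val + 1 = i ∨ j.val + 1 = i + 1 then (Sum.inr false : Fin n ⊕ Bool)
      else Sum.inl j))

theorem idPart_rel (p q : Fin n ⊕ Fin n) :
    (idPart (Fin n)) p q ↔ (p.elim id id).val = (q.elim id id).val := by
  rw [idPart, Setoid.ker_def]
  rcases p with p | p <;> rcases q with q | q <;> simp [Fin.ext_iff]

theorem stopPart_rel (i : ℕ) (p q : Fin n ⊕ Fin n) :
    (stopPart n i) p q ↔ (p.elim id id).val = (q.elim id id).val ∧
      (p.isLeft = q.isLeft ∨ (p.elim id id).val + 1 ≠ i) := by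
  rw [stopPart, Setoid.ker_def]
  rcases p with p | p <;> rcases q with q | q <;> simp only [Sum.elim_inl, Sum.elim_inr] <;>
    split_ifs <;> simp [Fin.ext_iff] <;> omega

theorem bridgePart_rel (i : ℕ) (p q : Fin n ⊕ Fin n) :
    (bridgePart n i) p q ↔ (p.elim id id).val = (q.elim id id).val ∨
      (((p.elim id id).val + 1 = i ∨ (p.elim id id).val = i) ∧
        ((q.elim id id).val + 1 = i ∨ (q.elim id id).val = i)) := by
  rw [bridgePart, Setoid.ker_def]
  rcases p with p | p <;> rcases q with q | q <;> simp only [Sum.elim_inl, Sum.elim_inr] <;>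
    split_ifs <;> simp [Fin.ext_iff] <;> omega

theorem hookPart_rel (i : ℕ) (p q : Fin n ⊕ Fin n) :
    (hookPart n i) p q ↔
      ((p.elim id id).val = (q.elim id id).val ∧ (p.elim id id).val + 1 ≠ i ∧
        (p.elim id id).val ≠ i) ∨
      (p.isLeft = q.isLeft ∧ ((p.elim id id).val + 1 = i ∨ (p.elim id id).val = i) ∧
        ((q.elim id id).val + 1 = i ∨ (q.elim id id).val = i)) := by
  rw [hookPart, Setoid.ker_def]
  rcases p with p | p <;> rcases q with q | q <;> simp only [Sum.elim_inl, Sum.elim_inr] <;>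
    split_ifs <;> simp [Fin.ext_iff] <;> omega

theorem idPart_planar (n : ℕ) : IsPlanar (idPart (Fin n)) := by
  intro p q r s
  simp only [idPart_rel]
  rcases p with p | p <;> rcases q with q | q <;> rcases r with r | r <;> rcases s with s | s <;>
    simp only [pos, Sum.elim_inl, Sum.elim_inr, id] <;> omega

theorem stopPart_planar (n i : ℕ) : IsPlanar (stopPart n i) := by
  intro p q r s
  simp only [stopPart_rel]
  rcases p with p | p <;> rcases q with q | q <;> rcases r with r | r <;> rcases s with s | s <;>
    simp [pos] <;> omega

theorem bridgePart_planar (n i : ℕ) : IsPlanar (bridgePart n i) := by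
  intro p q r s
  simp only [bridgePart_rel]
  rcases p with p | p <;> rcases q with q | q <;> rcases r with r | r <;> rcases s with s | s <;>
    simp only [pos, Sum.elim_inl, Sum.elim_inr, id] <;> omega

theorem hookPart_planar (n i : ℕ) : IsPlanar (hookPart n i) := by
  intro p q r s
  simp only [hookPart_rel]
  rcases p with p | p <;> rcases q with q | q <;> rcases r with r | r <;> rcases s with s | s <;>
    simp [pos] <;> omega

theorem idPart_matching (n : ℕ) : IsMatching (idPart (Fin n)) := by
  intro p
  refine ⟨p.swap, ⟨?_, ?_⟩, ?_⟩
  · rcases p with p | p <;> simp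
  · rw [idPart_rel]; rcases p with p | p <;> rfl
  · rintro q ⟨h, h'⟩
    rw [idPart_rel] at h'
    rcases p with p | p <;> rcases q with q | q <;> simp_all [Fin.ext_iff]

theorem hookPart_matching (n i : ℕ) (hi : 1 ≤ i ∧ i < n) : IsMatching (hookPart n i) := by
  intro p
  simp only [hookPart_rel]
  obtain ⟨k, rfl⟩ : ∃ k, i = k + 1 := ⟨i - 1, by omega⟩
  rcases p with p | p
  · by_cases h₁ : p.val = k
    · refine ⟨.inl ⟨k + 1, by omega⟩, ?_, ?_⟩
      · simp [Fin.ext_iff]; omega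
      · rintro (q | q) <;> simp [Fin.ext_iff] <;> omega
    · by_cases h₂ : p.val = k + 1
      · refine ⟨.inl ⟨k, by omega⟩, ?_, ?_⟩
        · simp [Fin.ext_iff]; omega
        · rintro (q | q) <;> simp [Fin.ext_iff] <;> omega
      · refine ⟨.inr p, ?_, ?_⟩
        · simp; omega
        · rintro (q | q) <;> simp [Fin.ext_iff] <;> omega
  · by_cases h₁ : p.val = k
    · refine ⟨.inr ⟨k + 1, by omega⟩, ?_, ?_⟩
      · simp [Fin.ext_iff]; omega
      · rintro (q | q) <;> simp [Fin.ext_iff] <;> omega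
    · by_cases h₂ : p.val = k + 1
      · refine ⟨.inr ⟨k, by omega⟩, ?_, ?_⟩
        · simp [Fin.ext_iff]; omega
        · rintro (q | q) <;> simp [Fin.ext_iff] <;> omega
      · refine ⟨.inl p, ?_, ?_⟩
        · simp; omega
        · rintro (q | q) <;> simp [Fin.ext_iff] <;> omega

end Generators

/-! ## The two monoids -/

/-- The `m`-cyclic planar partition monoid: planar partitions of the `2n` points, with internal
components counted modulo `m`. -/
noncomputable def PPa (m n : ℕ) : Submonoid (CyclicPartition m n) where
  carrier := {d | IsPlanar d.skeleton}
  mul_mem' := IsPlanar.comp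
  one_mem' := idPart_planar n

/-- The `m`-cyclic Temperley–Lieb monoid on `n` strands: crossingless matchings of the `2n` points,
with internal components counted modulo `m`. -/
noncomputable def TL (m n : ℕ) : Submonoid (CyclicPartition m n) where
  carrier := {d | IsPlanar d.skeleton ∧ IsMatching d.skeleton}
  mul_mem' h h' := ⟨h.1.comp h'.1, h.2.comp h'.2⟩
  one_mem' := ⟨idPart_planar n, idPart_matching n⟩

namespace PPa

/-- The identity diagram with one internal component. -/
def c (m n : ℕ) : PPa m n := ⟨⟨idPart (Fin n), 1⟩, idPart_planar n⟩

/-- The diagram `p_i`, for `1 ≤ i ≤ n`. -/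
def p (m n i : ℕ) : PPa m n := ⟨⟨stopPart n i, 0⟩, stopPart_planar n i⟩

/-- The diagram `p_{i+1/2}`, for `1 ≤ i < n`. -/
def pHalf (m n i : ℕ) : PPa m n := ⟨⟨bridgePart n i, 0⟩, bridgePart_planar n i⟩

end PPa

namespace TL

/-- The identity diagram with one internal component. -/
def o (m n : ℕ) : TL m n := ⟨⟨idPart (Fin n), 1⟩, idPart_planar n, idPart_matching n⟩

/-- The hook `u_i`, for `1 ≤ i < n`. -/
def u (m n i : ℕ) (hi : 1 ≤ i ∧ i < n) : TL m n :=
  ⟨⟨hookPart n i, 0⟩, hookPart_planar n i, hookPart_matching n i hi⟩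

end TL

end CyclicDiagram

/-! Thicken the blocks of a planar partition `a` and take boundary curves. Each point `x` on the
boundary of the strip becomes two points, and the boundary of the thickened blocks is the planar
matching `pairing (next a)`: it joins the second copy of `x` to the first copy of the next point of
its block. The homomorphism is `doubling`. It sends `(a, k)` to this matching with `2 * k + blocks a
- n` loops modulo `2 * m`. The identity, `p_i` and `p_{i+1/2}` have `n`, `n + 1` and `n - 1` blocks,
which explains the exponents `1` and `2 * m - 1` of `o`. The partition is recovered from `next a`,
whose cycles are its blocks, and doubling is injective on residues, so the map is injective.

Multiplicativity has two parts. The skeletons are compatible (`IsPlanar.comp_pairing`): the curves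
of the stacked matchings follow the permutation `stack (next a) (next b)` of the three rows, and its
first return to the outer rows is `next (comp a b)`. The loops are counted by
`IsPlanar.internalCount_pairing`: stacking the matchings creates `n + 2 * internalCount a b + blocks
(comp a b) - blocks a - blocks b` of them, exactly what the correction `blocks a - n` absorbs. This
follows from Euler's formula `IsPlanar.euler` for the stack, once the boundary walks that meet the
outer rows correspond to the blocks of the product (`IsPlanar.sameCycle_stack`).

Planarity of the stack enters as a genus-zero statement on transpositions. A list of transpositions
has a `genus`, comparing its length, the cycles of its product and the components it connects. This
quantity vanishes on the empty list and never decreases under insertion (`genus_le_insert`). For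
planar `a`, a shortest factorisation of `next a` extends to one of the full cycle `next ⊤` of total
length at most `2 * n - 1` (`IsPlanar.exists_complement`). For two full cycles the stacked genus is
bounded by zero by direct counting. By monotonicity it is zero for any two planar partitions, which
is Euler's formula. The full configuration keeps genus zero after one more transposition of outer
points, and this forces connected outer points onto one boundary walk. -/

namespace CyclicDiagram

open Equiv

/-! ### Counting and merging blocks of partitions -/

section SwapLists

variable {U : Type}

/-- The number of blocks of a partition. -/
noncomputable def blocks (r : Setoid U) : ℕ := Nat.card (Quotient r)

/-- The partition obtained by joining the block of `s` and the block of `t`. -/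
def merge (r : Setoid U) (s t : U) : Setoid U where
  r x y := r x y ∨ (r x s ∧ r t y) ∨ (r x t ∧ r s y)
  iseqv := by
    refine ⟨fun x => .inl (r.refl x), ?_, ?_⟩
    · rintro x y (h | ⟨h, h'⟩ | ⟨h, h'⟩)
      · exact .inl (r.symm h)
      · exact .inr (.inr ⟨r.symm h', r.symm h⟩)
      · exact .inr (.inl ⟨r.symm h', r.symm h⟩)
    · rintro x y z (h | ⟨h, h'⟩ | ⟨h, h'⟩) (g | ⟨g, g'⟩ | ⟨g, g'⟩)
      · exact .inl (r.trans h g)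
      · exact .inr (.inl ⟨r.trans h g, g'⟩)
      · exact .inr (.inr ⟨r.trans h g, g'⟩)
      · exact .inr (.inl ⟨h, r.trans h' g⟩)
      · exact .inr (.inl ⟨h, g'⟩)
      · exact .inl (r.trans h g')
      · exact .inr (.inr ⟨h, r.trans h' g⟩)
      · exact .inl (r.trans h g')
      · exact .inr (.inr ⟨h, g'⟩)

theorem merge_apply (r : Setoid U) (s t x y : U) :
    (merge r s t) x y ↔ r x y ∨ (r x s ∧ r t y) ∨ (r x t ∧ r s y) := Iff.rfl

theorem le_merge (r : Setoid U) (s t : U) : r ≤ merge r s t := fun _ _ h => .inl h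

theorem merge_pair (r : Setoid U) (s t : U) : (merge r s t) s t :=
  .inr (.inl ⟨r.refl s, r.refl t⟩)

theorem merge_le_iff {r q : Setoid U} {s t : U} : merge r s t ≤ q ↔ r ≤ q ∧ q s t := by
  refine ⟨fun h => ⟨(le_merge r s t).trans h, h (merge_pair r s t)⟩, ?_⟩
  rintro ⟨h, h'⟩ x y (g | ⟨g, g'⟩ | ⟨g, g'⟩)
  · exact h g
  · exact q.trans (h g) (q.trans h' (h g'))
  · exact q.trans (h g) (q.trans (q.symm h') (h g'))

theorem merge_of_rel {r : Setoid U} {s t : U} (h : r s t) : merge r s t = r :=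
  le_antisymm (merge_le_iff.2 ⟨le_rfl, h⟩) (le_merge r s t)

theorem blocks_le [Finite U] {r q : Setoid U} (h : r ≤ q) : blocks q ≤ blocks r :=
  Nat.card_le_card_of_surjective (Quotient.map' (s₁ := r) (s₂ := q) id fun _ _ g => h g) (by
    intro C
    induction C using Quotient.inductionOn with | _ u =>
    exact ⟨Quotient.mk r u, rfl⟩)

theorem blocks_bot : blocks (⊥ : Setoid U) = Nat.card U :=
  (Nat.card_congr (Equiv.ofBijective (Quotient.mk (⊥ : Setoid U))
    ⟨fun _ _ h => Quotient.exact h, Quotient.mk_surjective⟩)).symm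

theorem blocks_le_card [Finite U] (r : Setoid U) : blocks r ≤ Nat.card U :=
  blocks_bot (U := U) ▸ blocks_le bot_le

/-- Leaving out the block of `s`, the remaining blocks correspond to the merged ones, with the block
of `t` standing for the union. -/
theorem blocks_merge [Finite U] {r : Setoid U} {s t : U} (h : ¬ r s t) :
    blocks r = blocks (merge r s t) + 1 := by
  classical
  have e : {C : Quotient r // C ≠ Quotient.mk r s} ≃ Quotient (merge r s t) := by
    refine Equiv.ofBijective (fun C => Quotient.map' (s₁ := r) (s₂ := merge r s t) id
      (fun _ _ g => le_merge r s t g) C.1) ⟨?_, ?_⟩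
    · rintro ⟨C, hC⟩ ⟨D, hD⟩ hCD
      induction C using Quotient.inductionOn with | _ x =>
      induction D using Quotient.inductionOn with | _ y =>
      refine Subtype.ext (Quotient.sound ?_)
      rcases (Quotient.exact hCD : (merge r s t) x y) with g | ⟨g, -⟩ | ⟨-, g⟩
      · exact g
      · exact (hC (Quotient.sound g)).elim
      · exact (hD (Quotient.sound (r.symm g))).elim
    · intro C
      induction C using Quotient.inductionOn with | _ x =>
      by_cases hx : r x s
      · refine ⟨⟨Quotient.mk r t, fun g => h (r.symm (Quotient.exact g))⟩, Quotient.sound ?_⟩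
        exact .inr (.inr ⟨r.refl t, r.symm hx⟩)
      · exact ⟨⟨Quotient.mk r x, fun g => hx (Quotient.exact g)⟩, rfl⟩
  have := Fintype.ofFinite (Quotient r)
  have hpos : 0 < Fintype.card (Quotient r) := Fintype.card_pos_iff.2 ⟨Quotient.mk r s⟩
  rw [blocks, blocks, ← Nat.card_congr e, Nat.card_eq_fintype_card, Nat.card_eq_fintype_card,
    Fintype.card_subtype_compl, Fintype.card_subtype_eq]
  omega

theorem blocks_le_merge [Finite U] (r : Setoid U) (s t : U) :
    blocks r ≤ blocks (merge r s t) + 1 := by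
  by_cases h : r s t
  · rw [merge_of_rel h]; omega
  · exact (blocks_merge h).le

/-- The blocks of a partition are those that do not meet the image of `e` and those that do. -/
theorem blocks_eq_add_comap [Finite U] {O : Type} (r : Setoid U) (e : O → U) :
    blocks r = Nat.card {C : Quotient r // ∀ o, C ≠ Quotient.mk r (e o)} + blocks (r.comap e) := by
  classical
  have h : blocks (r.comap e) = Nat.card {C : Quotient r // ¬ ∀ o, C ≠ Quotient.mk r (e o)} := by
    refine Nat.card_congr (Equiv.ofBijective (fun C => ⟨Quotient.map' (s₁ := r.comap e) (s₂ := r) e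
      (fun _ _ g => g) C, ?_⟩) ⟨?_, ?_⟩)
    · induction C using Quotient.inductionOn with | _ o =>
      exact fun h => h o rfl
    · intro C D h
      induction C using Quotient.inductionOn with | _ o =>
      induction D using Quotient.inductionOn with | _ o' =>
      exact Quotient.sound (Quotient.exact (congrArg Subtype.val h) : r (e o) (e o'))
    · rintro ⟨C, hC⟩
      push Not at hC
      obtain ⟨o, rfl⟩ := hC
      exact ⟨Quotient.mk _ o, rfl⟩
  rw [h, ← Nat.card_sum]
  exact Nat.card_congr (Equiv.sumCompl _).symm

/-! ### Cycles of a permutation and components of a list of pairs -/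

/-- The partition into cycles. -/
abbrev cycles (π : Perm U) : Setoid U := Perm.SameCycle.setoid π

theorem cycles_le_iff {π : Perm U} {r : Setoid U} : cycles π ≤ r ↔ ∀ x, r x (π x) := by
  refine ⟨fun h x => h (⟨1, by simp⟩ : π.SameCycle x (π x)), fun h x y => ?_⟩
  rintro ⟨k, rfl⟩
  induction k with
  | zero => exact r.refl x
  | succ k ih =>
    rw [add_comm, zpow_add, zpow_one]
    exact r.trans ih (h _)
  | pred k ih =>
    refine r.trans ih (r.symm ?_)
    have := h ((π ^ (-(k : ℤ) - 1)) x)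
    rwa [← Perm.mul_apply, ← zpow_one_add, add_sub_cancel] at this

theorem cycles_self (π : Perm U) (x : U) : (cycles π) x (π x) := ⟨1, by simp⟩

/-- Forward invariance is enough, because on a finite set a cycle is exhausted by nonnegative
powers. -/
theorem mem_of_sameCycle [Finite U] {π : Perm U} {S : Set U} (hS : ∀ x ∈ S, π x ∈ S) {x y : U}
    (h : π.SameCycle x y) (hx : x ∈ S) : y ∈ S := by
  obtain ⟨k, -, rfl⟩ := h.exists_pow_eq'
  clear h
  induction k with
  | zero => exact hx
  | succ k ih => rw [pow_succ']; exact hS _ ih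

/-- The finest partition in which the pairs of a list are related. -/
def conn (l : List (U × U)) : Setoid U := l.foldr (fun p r => merge r p.1 p.2) ⊥

theorem conn_le_iff {l : List (U × U)} {r : Setoid U} :
    conn l ≤ r ↔ ∀ p ∈ l, r p.1 p.2 := by
  induction l with
  | nil => simp [conn]
  | cons p l ih =>
    rw [List.forall_mem_cons, ← ih]
    exact merge_le_iff.trans and_comm

/-- Unlike the product of transpositions, the components do not depend on the order of the list. -/
theorem conn_append_cons (l l' : List (U × U)) (p : U × U) :
    conn (l ++ p :: l') = merge (conn (l ++ l')) p.1 p.2 := by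
  refine eq_of_forall_ge_iff fun r => ?_
  rw [merge_le_iff, conn_le_iff, conn_le_iff]
  simp only [List.mem_append, List.mem_cons]
  refine ⟨fun h => ⟨fun q hq => h q (by tauto), h p (by tauto)⟩, ?_⟩
  rintro ⟨h, h'⟩ q (hq | rfl | hq)
  · exact h q (.inl hq)
  · exact h'
  · exact h q (.inr hq)

theorem card_le_blocks_conn [Finite U] (l : List (U × U)) :
    Nat.card U ≤ blocks (conn l) + l.length := by
  induction l with
  | nil => exact blocks_bot.ge
  | cons p l ih =>
    have := blocks_le_merge (conn l) p.1 p.2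
    change _ ≤ blocks (merge (conn l) p.1 p.2) + (l.length + 1)
    omega

/-- The number of cycles, fixed points included. -/
noncomputable def cycleCount (π : Perm U) : ℕ := blocks (cycles π)

theorem cycleCount_one : cycleCount (1 : Perm U) = Nat.card U := by
  rw [cycleCount, ← blocks_bot]
  congr 1
  exact le_bot_iff.1 (cycles_le_iff.2 fun x => rfl)

/-! ### Multiplication by one transposition -/

variable [DecidableEq U]

theorem cycles_swap_mul_le (π : Perm U) (s t : U) :
    cycles (swap s t * π) ≤ merge (cycles π) s t := by
  refine cycles_le_iff.2 fun x => ?_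
  rw [Perm.mul_apply]
  rcases eq_or_ne (π x) s with h | h
  · rw [h, swap_apply_left]
    exact .inr (.inl ⟨h ▸ cycles_self π x, (cycles π).refl t⟩)
  · rcases eq_or_ne (π x) t with h' | h'
    · rw [h', swap_apply_right]
      exact .inr (.inr ⟨h' ▸ cycles_self π x, (cycles π).refl s⟩)
    · rw [swap_apply_of_ne_of_ne h h']
      exact .inl (cycles_self π x)

theorem cycles_le_swap_mul (π : Perm U) (s t : U) :
    cycles π ≤ merge (cycles (swap s t * π)) s t := by
  have := cycles_swap_mul_le (swap s t * π) s t
  rwa [← mul_assoc, swap_mul_self, one_mul] at this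

/-- A transposition across two cycles joins them: the new walk from `s` follows `π` until the first
return to `s`, where it is diverted to `t`. -/
theorem sameCycle_swap_mul [Finite U] {π : Perm U} {s t : U} (h : ¬ π.SameCycle s t) :
    (swap s t * π).SameCycle t s := by
  have key : ∀ k : ℕ, (π ^ (k + 1)) s = s → (swap s t * π).SameCycle s t := by
    intro k hk
    classical
    let k₀ := Nat.find (⟨k, hk⟩ : ∃ k, (π ^ (k + 1)) s = s)
    have hk₀ : (π ^ (k₀ + 1)) s = s := Nat.find_spec (⟨k, hk⟩ : ∃ k, (π ^ (k + 1)) s = s)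
    have hlt : ∀ j < k₀, (π ^ (j + 1)) s ≠ s := fun j hj =>
      Nat.find_min (⟨k, hk⟩ : ∃ k, (π ^ (k + 1)) s = s) hj
    -- Before the first return the orbit avoids `s`, and it never meets `t`, so the transposition
    -- has no effect.
    have hpow : ∀ j ≤ k₀, ((swap s t * π) ^ j) s = (π ^ j) s := by
      intro j
      induction j with
      | zero => intro _; rfl
      | succ j ih =>
        intro hj
        rw [pow_succ', Perm.mul_apply, ih (by omega), Perm.mul_apply, ← Perm.mul_apply π,
          ← pow_succ', swap_apply_of_ne_of_ne (hlt j (by omega))]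
        rintro hjt
        exact h ⟨(j + 1 : ℕ), by rw [zpow_natCast]; exact hjt⟩
    refine ⟨(k₀ + 1 : ℕ), ?_⟩
    rw [zpow_natCast, pow_succ', Perm.mul_apply, hpow k₀ le_rfl, Perm.mul_apply,
      ← Perm.mul_apply π, ← pow_succ', hk₀, swap_apply_left]
  obtain ⟨m, hm, hm'⟩ := isOfFinOrder_iff_pow_eq_one.1 (isOfFinOrder_of_finite π)
  obtain ⟨k, rfl⟩ : ∃ k, m = k + 1 := ⟨m - 1, by omega⟩
  exact (key k (by rw [hm']; rfl)).symm

/-- A transposition inside a cycle splits it: the segment of the orbit from `s` up to just before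
`t` closes up on itself. -/
theorem not_sameCycle_swap_mul [Finite U] {π : Perm U} {s t : U} (hst : s ≠ t)
    (h : π.SameCycle s t) : ¬ (swap s t * π).SameCycle s t := by
  obtain ⟨k, hk⟩ : ∃ k : ℕ, (π ^ k) s = t := by
    obtain ⟨k, -, hk⟩ := h.exists_pow_eq'
    exact ⟨k, hk⟩
  classical
  let k₀ := Nat.find (⟨k, hk⟩ : ∃ k, (π ^ k) s = t)
  have hk₀ : (π ^ k₀) s = t := Nat.find_spec (⟨k, hk⟩ : ∃ k, (π ^ k) s = t)
  have hlt : ∀ j < k₀, (π ^ j) s ≠ t := fun j hj =>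
    Nat.find_min (⟨k, hk⟩ : ∃ k, (π ^ k) s = t) hj
  have hpos : 0 < k₀ := by
    rcases Nat.eq_zero_or_pos k₀ with h0 | h0
    · rw [h0] at hk₀; exact (hst hk₀).elim
    · exact h0
  intro hs
  obtain ⟨j, hj, hjt⟩ : t ∈ {x | ∃ j < k₀, (π ^ j) s = x} := by
    refine mem_of_sameCycle ?_ hs ⟨0, hpos, rfl⟩
    rintro x ⟨j, hj, rfl⟩
    rw [Perm.mul_apply, ← Perm.mul_apply π, ← pow_succ']
    rcases Nat.lt_or_ge (j + 1) k₀ with h' | h'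
    · refine ⟨j + 1, h', ?_⟩
      rw [swap_apply_of_ne_of_ne ?_ (hlt _ h')]
      intro hjs
      -- A return to `s` after `j + 1` steps would let `t` be reached `j + 1` steps sooner, against
      -- the minimality of `k₀`.
      refine hlt (k₀ - (j + 1)) (by omega) ?_
      have : (π ^ (k₀ - (j + 1) + (j + 1))) s = t := by
        rw [Nat.sub_add_cancel h'.le]; exact hk₀
      rwa [pow_add, Perm.mul_apply, hjs] at this
    · obtain h' : j + 1 = k₀ := by omega
      exact ⟨0, hpos, by rw [h', hk₀, swap_apply_right]; rfl⟩
  exact hlt j hj hjt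

theorem cycleCount_swap_mul_le [Finite U] (π : Perm U) (s t : U) :
    cycleCount (swap s t * π) ≤ cycleCount π + 1 :=
  (blocks_le_merge _ s t).trans (Nat.add_le_add_right (blocks_le (cycles_le_swap_mul π s t)) 1)

/-- The cycles of the new permutation are coarser than the old ones and contain `s` and `t`
together, so at least one cycle is lost. -/
theorem cycleCount_swap_mul_lt [Finite U] {π : Perm U} {s t : U} (h : ¬ π.SameCycle s t) :
    cycleCount (swap s t * π) + 1 ≤ cycleCount π := by
  rw [cycleCount, cycleCount, blocks_merge (r := cycles π) h]
  exact Nat.add_le_add_right (blocks_le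
    (merge_le_iff.2 ⟨(cycles_le_swap_mul π s t).trans
      (merge_le_iff.2 ⟨le_rfl, (sameCycle_swap_mul h).symm⟩), (sameCycle_swap_mul h).symm⟩)) 1

theorem lt_cycleCount_swap_mul [Finite U] {π : Perm U} {s t : U} (hst : s ≠ t)
    (h : π.SameCycle s t) : cycleCount π + 1 ≤ cycleCount (swap s t * π) := by
  have := cycleCount_swap_mul_lt (not_sameCycle_swap_mul hst h)
  rwa [← mul_assoc, swap_mul_self, one_mul] at this

/-! ### The genus of a list of transpositions -/

/-- The product of the transpositions of a list of pairs. -/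
def swapProd (l : List (U × U)) : Perm U := (l.map fun p => swap p.1 p.2).prod

theorem swapProd_append (l l' : List (U × U)) :
    swapProd (l ++ l') = swapProd l * swapProd l' := by
  simp [swapProd]

theorem swapProd_cons (p : U × U) (l : List (U × U)) :
    swapProd (p :: l) = swap p.1 p.2 * swapProd l := by
  simp [swapProd]

theorem cycles_swapProd_le (l : List (U × U)) : cycles (swapProd l) ≤ conn l := by
  induction l with
  | nil => exact cycles_le_iff.2 fun x => Setoid.refl' _ x
  | cons p l ih =>
    rw [swapProd_cons]
    exact (cycles_swap_mul_le _ _ _).trans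
      (merge_le_iff.2 ⟨ih.trans (le_merge _ _ _), merge_pair _ _ _⟩)

/-- Twice the genus of a list of transpositions. -/
noncomputable def genus (l : List (U × U)) : ℤ :=
  l.length + (Nat.card U - cycleCount (swapProd l)) - 2 * (Nat.card U - blocks (conn l))

theorem genus_nil : genus ([] : List (U × U)) = 0 := by
  have h : swapProd ([] : List (U × U)) = 1 := rfl
  have h' : conn ([] : List (U × U)) = ⊥ := rfl
  rw [genus, h, h', cycleCount_one, blocks_bot]
  simp

/-- Inside a component the new transposition adds one to the length and at most one cycle. Across
two components it joins two cycles and two components, and the contributions `1 + 1 - 2` cancel. -/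
theorem genus_le_insert [Finite U] (l l' : List (U × U)) (p : U × U) :
    genus (l ++ l') ≤ genus (l ++ p :: l') := by
  -- Moving the inserted transposition to the front conjugates it by the product of the preceding
  -- ones. The conjugated points remain in the components of the original points.
  have hprod : swapProd (l ++ p :: l') =
      swap (swapProd l p.1) (swapProd l p.2) * swapProd (l ++ l') := by
    rw [swapProd_append, swapProd_append, swapProd_cons, ← mul_assoc, ← mul_assoc,
      mul_swap_eq_swap_mul]
  rw [genus, genus, hprod, conn_append_cons]
  have hlen : (l ++ p :: l').length = (l ++ l').length + 1 := by simp; omega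
  rw [hlen]
  by_cases h : (conn (l ++ l')) p.1 p.2
  · rw [merge_of_rel h]
    have := cycleCount_swap_mul_le (swapProd (l ++ l')) (swapProd l p.1) (swapProd l p.2)
    push_cast
    linarith [(Int.ofNat_le.2 this)]
  · have hl : conn l ≤ conn (l ++ l') := conn_le_iff.2 fun q hq =>
      conn_le_iff.1 le_rfl q (List.mem_append_left _ hq)
    have h' : ¬ (swapProd (l ++ l')).SameCycle (swapProd l p.1) (swapProd l p.2) := fun hs =>
      h (Setoid.trans' _ (hl (cycles_swapProd_le l (cycles_self _ _)))
        (Setoid.trans' _ (cycles_swapProd_le _ hs)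
          (Setoid.symm' _ (hl (cycles_swapProd_le l (cycles_self _ _))))))
    have h₁ := cycleCount_swap_mul_lt h'
    have h₂ := blocks_merge h
    push_cast
    omega

theorem genus_le_of_sublist [Finite U] {l l' : List (U × U)} (h : l.Sublist l') :
    genus l ≤ genus l' := by
  -- The arbitrary prefix collects the entries common to both lists, so that insertion may happen in
  -- the middle.
  suffices H : ∀ k : List (U × U), genus (k ++ l) ≤ genus (k ++ l') from H []
  induction h with
  | slnil => exact fun k => le_rfl
  | cons a _ ih => exact fun k => (ih k).trans (genus_le_insert k _ a)
  | cons_cons a _ ih =>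
    intro k
    simpa using ih (k ++ [a])

theorem genus_nonneg [Finite U] (l : List (U × U)) : 0 ≤ genus l := by
  rw [← genus_nil (U := U)]
  exact genus_le_of_sublist (List.nil_sublist l)

/-- In genus zero, inserting a transposition inside a component without raising the genus
splits a cycle. -/
theorem sameCycle_of_genus_le [Finite U] {l : List (U × U)} {s t : U}
    (hg : genus ((s, t) :: l) ≤ genus l) (h : (conn l) s t) : (swapProd l).SameCycle s t := by
  -- Joining two cycles within a component would raise the genus by two: one for the length, one for
  -- the lost cycle.
  by_contra hs
  have h₁ := cycleCount_swap_mul_lt hs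
  have h₂ : conn ((s, t) :: l) = conn l := merge_of_rel h
  rw [genus, genus, h₂, swapProd_cons] at hg
  simp only [List.length_cons] at hg
  push_cast at hg
  omega

/-- Every permutation is a product of as few transpositions as its number of cycles allows. -/
theorem exists_swapProd_eq [Finite U] (π : Perm U) :
    ∃ l : List (U × U), swapProd l = π ∧ conn l = cycles π ∧
      l.length + cycleCount π ≤ Nat.card U := by
  obtain ⟨k, hk⟩ : ∃ k, k = Nat.card U - cycleCount π := ⟨_, rfl⟩
  induction k using Nat.strong_induction_on generalizing π with
  | _ k ih =>
  by_cases hπ : π = 1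
  · subst hπ
    refine ⟨[], rfl, ?_, by simp [cycleCount_one]⟩
    exact le_antisymm (conn_le_iff.2 (by simp)) (cycles_le_iff.2 fun x => Setoid.refl' _ x)
  · obtain ⟨s, hs⟩ : ∃ s, π s ≠ s := by
      by_contra! h
      exact hπ (Perm.ext h)
    -- The transposition of `s` and `π s` makes `s` a fixed point, so the number of cycles grows and
    -- the induction applies.
    have hc := lt_cycleCount_swap_mul hs.symm (cycles_self π s)
    obtain ⟨l, h₁, h₂, h₃⟩ := ih _ (by
      have := blocks_le_card (cycles (swap s (π s) * π))
      rw [← cycleCount] at this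
      omega)
      (swap s (π s) * π) rfl
    refine ⟨(s, π s) :: l, ?_, ?_, ?_⟩
    · rw [swapProd_cons, h₁, ← mul_assoc, swap_mul_self, one_mul]
    · change merge (conn l) s (π s) = _
      rw [h₂]
      refine le_antisymm (merge_le_iff.2 ⟨?_, cycles_self π s⟩) (cycles_le_swap_mul π _ _)
      refine (cycles_swap_mul_le π _ _).trans ?_
      rw [merge_of_rel (r := cycles π) (cycles_self π s)]
    · simp only [List.length_cons]; omega

end SwapLists

/-! ### The successor permutation of a partition -/

section Next

variable {n : ℕ}

theorem pos_ne {p q : Fin n ⊕ Fin n} (h : p ≠ q) : pos p ≠ pos q := fun h' => h (pos_injective h')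

theorem pos_nonneg (p : Fin n ⊕ Fin n) : 0 ≤ pos p := by
  rcases p with p | p <;> have := p.2 <;> simp only [pos] <;> omega

theorem pos_lt (p : Fin n ⊕ Fin n) : pos p < 2 * n := by
  rcases p with p | p <;> have := p.2 <;> simp only [pos] <;> omega

theorem exists_pos_eq {k : ℤ} (h : 0 ≤ k) (h' : k < 2 * n) : ∃ p : Fin n ⊕ Fin n, pos p = k := by
  rcases lt_or_ge k n with hk | hk
  · exact ⟨.inl ⟨k.toNat, by omega⟩, by simp only [pos]; omega⟩
  · exact ⟨.inr ⟨(2 * n - 1 - k).toNat, by omega⟩, by simp only [pos]; omega⟩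

/-- The point `z` lies strictly between `x` and `y`, going around the strip from `x` to `y`. -/
def Arc (x y z : Fin n ⊕ Fin n) : Prop :=
  -- When `y = x` the arc goes once around and contains every other point, so the successor in a
  -- singleton block is the point itself.
  (pos x < pos z ∧ pos z < pos y) ∨ (pos y ≤ pos x ∧ (pos x < pos z ∨ pos z < pos y))

/-- The point `y` is the next point of the block of `x`, going around the strip. -/
def IsNext (a : Setoid (Fin n ⊕ Fin n)) (x y : Fin n ⊕ Fin n) : Prop :=
  a x y ∧ ∀ z, Arc x y z → ¬ a x z

/-- If `z` and `w` were on different sides of the chord from `x` to `y`, two distinct blocks would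
cross. This is the form in which planarity is used below. -/
theorem IsPlanar.arc {a : Setoid (Fin n ⊕ Fin n)} (ha : IsPlanar a) {x y z w : Fin n ⊕ Fin n}
    (hxy : a x y) (hzw : a z w) (hxz : ¬ a x z) (h : Arc x y z) : Arc x y w := by
  have hyz : ¬ a y z := fun h => hxz (a.trans hxy h)
  have hxw : ¬ a x w := fun h => hxz (a.trans h (a.symm hzw))
  have hyw : ¬ a y w := fun h => hxw (a.trans hxy h)
  have n₁ : pos x ≠ pos w := pos_ne fun h => hxw (h ▸ a.refl x)
  have n₂ : pos y ≠ pos w := pos_ne fun h => hyw (h ▸ a.refl y)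
  have c : ∀ p q r s, a p r → a q s → ¬ a p q → ¬ (pos p < pos q ∧ pos q < pos r ∧ pos r < pos s) :=
    fun p q r s h₁ h₂ h₃ h => h₃ (ha p q r s h.1 h.2.1 h.2.2 h₁ h₂)
  have hyx := a.symm hxy
  have hwz := a.symm hzw
  have c₁ := c x z y w hxy hzw hxz
  have c₂ := c y w x z hyx hwz hyw
  have c₃ := c z y w x hzw hyx fun h => hyz (a.symm h)
  have c₄ := c w x z y hwz hxy fun h => hxw (a.symm h)
  clear c
  simp only [Arc] at h ⊢
  rcases h with h | ⟨h, h | h⟩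
  · left; omega
  · right; omega
  · right; omega

theorem exists_isNext (a : Setoid (Fin n ⊕ Fin n)) (x : Fin n ⊕ Fin n) : ∃ y, IsNext a x y := by
  -- The successor is the nearest later point of the block, or its first point when `x` is the last
  -- one.
  by_cases h : ∃ z, a x z ∧ pos x < pos z
  · obtain ⟨y, ⟨hy, hxy⟩, hmin⟩ := Set.exists_min_image {z | a x z ∧ pos x < pos z} pos
      (Set.toFinite _) h
    refine ⟨y, hy, fun z hz hxz => ?_⟩
    have := hmin z
    simp only [Set.mem_ofPred_eq, hxz, true_and] at this
    simp only [Arc] at hz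
    omega
  · push Not at h
    obtain ⟨y, hy, hmin⟩ := Set.exists_min_image {z | a x z} pos (Set.toFinite _) ⟨x, a.refl x⟩
    refine ⟨y, hy, fun z hz hxz => ?_⟩
    have h₁ := hmin z hxz
    have h₂ := h z hxz
    simp only [Arc] at hz
    omega

theorem IsNext.unique {a : Setoid (Fin n ⊕ Fin n)} {x y y' : Fin n ⊕ Fin n} (h : IsNext a x y)
    (h' : IsNext a x y') : y = y' := by
  by_contra hne
  have h₀ := pos_ne hne
  have h₁ : ¬ Arc x y y' := fun h₃ => h.2 y' h₃ h'.1
  have h₂ : ¬ Arc x y' y := fun h₃ => h'.2 y h₃ h.1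
  simp only [Arc] at h₁ h₂
  omega

theorem IsNext.injective {a : Setoid (Fin n ⊕ Fin n)} {x x' y : Fin n ⊕ Fin n} (h : IsNext a x y)
    (h' : IsNext a x' y) : x = x' := by
  by_contra hne
  have h₀ := pos_ne hne
  have hx := a.trans h.1 (a.symm h'.1)
  have h₁ : ¬ Arc x y x' := fun h₃ => h.2 x' h₃ hx
  have h₂ : ¬ Arc x' y x := fun h₃ => h'.2 x h₃ (a.symm hx)
  simp only [Arc] at h₁ h₂
  omega

/-- The permutation that sends a point to the next point of its block, going around the strip. -/
noncomputable def next (a : Setoid (Fin n ⊕ Fin n)) : Perm (Fin n ⊕ Fin n) :=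
  Equiv.ofBijective (fun x => (exists_isNext a x).choose) (Finite.injective_iff_bijective.1
    fun x x' h => (exists_isNext a x).choose_spec.injective (by
      have h : (exists_isNext a x).choose = (exists_isNext a x').choose := h
      rw [h]
      exact (exists_isNext a x').choose_spec))

theorem next_isNext (a : Setoid (Fin n ⊕ Fin n)) (x : Fin n ⊕ Fin n) : IsNext a x (next a x) :=
  (exists_isNext a x).choose_spec

theorem next_rel (a : Setoid (Fin n ⊕ Fin n)) (x : Fin n ⊕ Fin n) : a x (next a x) :=
  (next_isNext a x).1

theorem next_eq_iff {a : Setoid (Fin n ⊕ Fin n)} {x y : Fin n ⊕ Fin n} :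
    next a x = y ↔ IsNext a x y :=
  ⟨fun h => h ▸ next_isNext a x, fun h => (next_isNext a x).unique h⟩

/-- Repeatedly passing to the successor approaches any later point of the block without overshooting
it. Consequently `next a` determines `a`. -/
theorem cycles_next (a : Setoid (Fin n ⊕ Fin n)) : cycles (next a) = a := by
  refine le_antisymm (cycles_le_iff.2 (next_rel a)) ?_
  have key : ∀ k : ℕ, ∀ x y : Fin n ⊕ Fin n, a x y → pos x ≤ pos y → (pos y - pos x).toNat = k →
      (cycles (next a)) x y := by
    intro k
    induction k using Nat.strong_induction_on with
    | _ k ih =>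
    intro x y hxy hle hk
    by_cases h : x = y
    · rw [h]
    · have h₁ := pos_ne h
      have h₂ : ¬ Arc x (next a x) y := fun h₃ => (next_isNext a x).2 y h₃ hxy
      simp only [Arc] at h₂
      exact Setoid.trans' _ (cycles_self _ x) (ih _ (by omega) _ y
        (a.trans (a.symm (next_rel a x)) hxy) (by omega) rfl)
  intro x y hxy
  rcases le_total (pos x) (pos y) with h | h
  · exact key _ x y hxy h rfl
  · exact Setoid.symm' _ (key _ y x (a.symm hxy) h rfl)

theorem next_injective : Function.Injective (next (n := n)) := fun a b h => by
  rw [← cycles_next a, h, cycles_next]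

/-! ### Merging neighbouring blocks and the Kreweras complement -/

/-- Merging the blocks of two neighbouring points preserves planarity. -/
theorem IsPlanar.merge {a : Setoid (Fin n ⊕ Fin n)} (ha : IsPlanar a) {s t : Fin n ⊕ Fin n}
    (hst : pos t = pos s + 1) : IsPlanar (merge a s t) := by
  have c : ∀ p q r s, a p r → a q s → ¬ a p q →
      ¬ (pos p < pos q ∧ pos q < pos r ∧ pos r < pos s) :=
    fun p q r s h₁ h₂ h₃ h => h₃ (ha p q r s h.1 h.2.1 h.2.2 h₁ h₂)
  -- A block other than those of `s` and `t` separates neither of them from the other.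
  have aux : ∀ p r q w, a p s → a t r → a q w → ¬ a q s → ¬ a q t →
      (Arc q w p ↔ Arc q w r) := by
    intro p r q w hp hr hq hqs hqt
    have hws : ¬ a w s := fun h => hqs (a.trans hq h)
    have hwt : ¬ a w t := fun h => hqt (a.trans hq h)
    have e₁ : Arc q w p ↔ Arc q w s :=
      ⟨ha.arc hq hp fun h => hqs (a.trans h hp),
        ha.arc hq (a.symm hp) hqs⟩
    have e₂ : Arc q w t ↔ Arc q w r :=
      ⟨ha.arc hq hr hqt, ha.arc hq (a.symm hr) fun h => hqt (a.trans h (a.symm hr))⟩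
    rw [e₁, ← e₂]
    have n₁ := pos_ne fun h : q = s => hqs (h ▸ a.refl q)
    have n₂ := pos_ne fun h : q = t => hqt (h ▸ a.refl q)
    have n₃ := pos_ne fun h : w = s => hws (h ▸ a.refl w)
    have n₄ := pos_ne fun h : w = t => hwt (h ▸ a.refl w)
    simp only [Arc]
    omega
  intro p q r w h₁ h₂ h₃ hpr hqw
  by_contra hpq
  have hout : ∀ {x y z : Fin n ⊕ Fin n}, (x = s ∨ x = t) → a y x → (a z s ∨ a z t) →
      (CyclicDiagram.merge a s t) y z := by
    rintro x y z (rfl | rfl) hy (hz | hz)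
    · exact .inl (a.trans hy (a.symm hz))
    · exact .inr (.inl ⟨hy, a.symm hz⟩)
    · exact .inr (.inr ⟨hy, a.symm hz⟩)
    · exact .inl (a.trans hy (a.symm hz))
  have mono := le_merge a s t
  have hnpq : ¬ a p q := fun h => hpq (mono h)
  by_cases hp : a p r
  · rcases hqw with hqw | ⟨hq, hw⟩ | ⟨hq, hw⟩
    · exact c p q r w hp hqw hnpq ⟨h₁, h₂, h₃⟩
    · have := aux q w p r hq hw hp (fun h => hpq (hout (.inl rfl) h (.inl hq)))
        (fun h => hpq (hout (.inr rfl) h (.inl hq)))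
      simp only [Arc] at this
      omega
    · have := aux w q p r (a.symm hw) (a.symm hq) hp
        (fun h => hpq (hout (.inl rfl) h (.inr hq)))
        (fun h => hpq (hout (.inr rfl) h (.inr hq)))
      simp only [Arc] at this
      omega
  · have hq : a p s ∨ a p t := by
      rcases hpr with h | ⟨h, -⟩ | ⟨h, -⟩
      · exact (hp h).elim
      · exact .inl h
      · exact .inr h
    have hqs : ¬ a q s := fun h =>
      hpq (Setoid.symm' _ (hout (.inl rfl) h hq))
    have hqt : ¬ a q t := fun h =>
      hpq (Setoid.symm' _ (hout (.inr rfl) h hq))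
    have hqw : a q w := by
      rcases hqw with h | ⟨h, -⟩ | ⟨h, -⟩
      · exact h
      · exact (hqs h).elim
      · exact (hqt h).elim
    rcases hpr with h | ⟨h, h'⟩ | ⟨h, h'⟩
    · exact hp h
    · have := aux p r q w h h' hqw hqs hqt
      simp only [Arc] at this
      omega
    · have := aux r p q w (a.symm h') (a.symm h) hqw hqs hqt
      simp only [Arc] at this
      omega

/-- Merging the blocks of two neighbouring points multiplies `next` by a transposition. -/
theorem IsPlanar.next_merge {a : Setoid (Fin n ⊕ Fin n)} (ha : IsPlanar a) {s t : Fin n ⊕ Fin n}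
    (hst : pos t = pos s + 1) (hne : ¬ a s t) :
    next (CyclicDiagram.merge a s t) = swap (next a s) t * next a := by
  refine Perm.ext fun x => next_eq_iff.2 ?_
  have hs := next_isNext a s
  rw [Perm.mul_apply]
  -- Three cases: the successor of `s` becomes its neighbour `t`; the old predecessor of `t` is sent
  -- to the old successor of `s`; every other successor is unchanged.
  rcases eq_or_ne x s with rfl | hxs
  · rw [swap_apply_left]
    refine ⟨merge_pair a x t, fun z hz => ?_⟩
    simp only [Arc] at hz
    omega
  rw [swap_apply_def, if_neg fun h => hxs ((next a).injective h)]
  have hx := next_isNext a x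
  split_ifs with hxt
  · rw [hxt] at hx
    have hxs' : ¬ a x s := fun h => hne (a.trans (a.symm h) hx.1)
    refine ⟨.inr (.inr ⟨hx.1, hs.1⟩), ?_⟩
    have hts : ¬ a s x := fun h => hxs' (a.symm h)
    -- Before merging, the block of `t` stays on one side of the chord from `s` to its successor,
    -- which puts `x` on the side of `t`.
    have e₁ : Arc s (next a s) t → Arc s (next a s) x := ha.arc hs.1 (a.symm hx.1) hne
    have n₁ := pos_ne fun h : next a s = t => hne (h ▸ hs.1)
    rintro z hz (h | ⟨h, -⟩ | ⟨-, h⟩)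
    · have h₁ : ¬ Arc x t z := fun h' => hx.2 z h' h
      simp only [Arc] at e₁ h₁ hz
      omega
    · exact hxs' h
    · have h₁ : ¬ Arc s (next a s) z := fun h' => hs.2 z h' h
      simp only [Arc] at e₁ h₁ hz
      omega
  · have n₁ := pos_ne hxs
    have n₂ := pos_ne hxt
    refine ⟨.inl hx.1, ?_⟩
    rintro z hz (h | ⟨h, h'⟩ | ⟨h, h'⟩)
    · exact hx.2 z hz h
    · have h₁ : ¬ Arc x (next a x) s := fun h' => hx.2 s h' h
      have h₂ := ha.arc hx.1 (a.symm h') (fun h₃ => hne (a.trans (a.symm h)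
        (a.trans h₃ (a.symm h')))) hz
      simp only [Arc] at h₁ h₂
      omega
    · have h₁ : ¬ Arc x (next a x) t := fun h' => hx.2 t h' h
      have h₂ := ha.arc hx.1 (a.symm h') (fun h₃ => hne (a.trans h' (a.trans (a.symm h₃) h))) hz
      simp only [Arc] at h₁ h₂
      omega

/-- If all consecutive points were related, a chain of neighbours would relate any two points. -/
theorem exists_not_rel_of_ne_top {a : Setoid (Fin n ⊕ Fin n)} (ha : a ≠ ⊤) :
    ∃ s t, pos t = pos s + 1 ∧ ¬ a s t := by
  by_contra! h
  refine ha (top_le_iff.1 ?_)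
  have key : ∀ k : ℕ, ∀ x y : Fin n ⊕ Fin n, pos y = pos x + k → a x y := by
    intro k
    induction k with
    | zero =>
      intro x y hxy
      rw [pos_injective (show pos x = pos y by simp at hxy; omega)]
    | succ k ih =>
      intro x y hxy
      push_cast at hxy
      have := pos_nonneg x
      have := pos_lt y
      obtain ⟨z, hz⟩ := exists_pos_eq (n := n) (k := pos x + k) (by omega) (by omega)
      exact a.trans (ih x z hz) (h z y (by omega))
  intro x y _
  rcases le_total (pos x) (pos y) with h | h
  · exact key (pos y - pos x).toNat x y (by omega)
  · exact a.symm (key (pos x - pos y).toNat y x (by omega))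

/-- The Kreweras complement of a planar partition, as a list of transpositions. -/
theorem IsPlanar.exists_complement {a : Setoid (Fin n ⊕ Fin n)} (ha : IsPlanar a) :
    ∃ l : List ((Fin n ⊕ Fin n) × (Fin n ⊕ Fin n)),
      swapProd l * next a = next ⊤ ∧ l.length ≤ blocks a - 1 := by
  obtain ⟨k, hk⟩ : ∃ k, k = blocks a := ⟨_, rfl⟩
  induction k using Nat.strong_induction_on generalizing a with
  | _ k ih =>
  by_cases htop : a = ⊤
  · exact ⟨[], by rw [htop]; rfl, Nat.zero_le _⟩
  · obtain ⟨s, t, hst, hne⟩ := exists_not_rel_of_ne_top htop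
    have hb := blocks_merge hne
    obtain ⟨l, h₁, h₂⟩ := ih _ (by omega) (ha.merge hst) rfl
    have hpos : 0 < blocks (CyclicDiagram.merge a s t) :=
      Nat.card_pos_iff.2 ⟨⟨Quotient.mk _ s⟩, inferInstance⟩
    -- Each merge costs one transposition and one block. It stands last because in the product it
    -- acts on `next a` first.
    refine ⟨l ++ [(next a s, t)], ?_, ?_⟩
    · rw [← h₁, ha.next_merge hst hne, swapProd_append, mul_assoc]
      simp [swapProd]
    · simp only [List.length_append, List.length_singleton]
      omega

/-! ### Matchings of the doubled strip -/

/-- The points of the doubled strip: every point `x` is replaced by two points, of which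
`minusPt x` comes first when going around the strip. -/
def minusPt : Fin n ⊕ Fin n → Fin (2 * n) ⊕ Fin (2 * n) :=
  Sum.map (fun i => ⟨2 * i, by omega⟩) (fun i => ⟨2 * i + 1, by omega⟩)

/-- The second of the two points that replace a point in the doubled strip. -/
def plusPt : Fin n ⊕ Fin n → Fin (2 * n) ⊕ Fin (2 * n) :=
  Sum.map (fun i => ⟨2 * i + 1, by omega⟩) (fun i => ⟨2 * i, by omega⟩)

theorem pos_minusPt (x : Fin n ⊕ Fin n) : pos (minusPt x) = 2 * pos x := by
  rcases x with x | x <;> simp only [minusPt, pos, Sum.map_inl, Sum.map_inr] <;> push_cast <;> ring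

theorem pos_plusPt (x : Fin n ⊕ Fin n) : pos (plusPt x) = 2 * pos x + 1 := by
  rcases x with x | x <;> simp only [plusPt, pos, Sum.map_inl, Sum.map_inr] <;> push_cast <;> ring

theorem eq_minusPt_or_plusPt (q : Fin (2 * n) ⊕ Fin (2 * n)) :
    ∃ x : Fin n ⊕ Fin n, q = minusPt x ∨ q = plusPt x := by
  have h₁ := pos_nonneg q
  have h₂ := pos_lt q
  obtain ⟨x, hx⟩ := exists_pos_eq (n := n) (k := pos q / 2) (by omega) (by omega)
  refine ⟨x, ?_⟩
  rcases Int.emod_two_eq_zero_or_one (pos q) with h | h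
  · exact .inl (pos_injective (by rw [pos_minusPt]; omega))
  · exact .inr (pos_injective (by rw [pos_plusPt]; omega))

theorem minusPt_injective : Function.Injective (minusPt (n := n)) := fun x y h =>
  pos_injective (by have := congrArg pos h; rw [pos_minusPt, pos_minusPt] at this; omega)

theorem plusPt_injective : Function.Injective (plusPt (n := n)) := fun x y h =>
  pos_injective (by have := congrArg pos h; rw [pos_plusPt, pos_plusPt] at this; omega)

theorem minusPt_ne_plusPt (x y : Fin n ⊕ Fin n) : minusPt x ≠ plusPt y := fun h => by
  have := congrArg pos h
  rw [pos_minusPt, pos_plusPt] at this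
  omega

/-- A function on the doubled strip, given by its values on the two copies of the strip. -/
noncomputable def doubleRec {T : Type} (f g : Fin n ⊕ Fin n → T)
    (q : Fin (2 * n) ⊕ Fin (2 * n)) : T :=
  open Classical in
  if q = minusPt (eq_minusPt_or_plusPt q).choose then f (eq_minusPt_or_plusPt q).choose
  else g (eq_minusPt_or_plusPt q).choose

theorem doubleRec_minusPt {T : Type} (f g : Fin n ⊕ Fin n → T) (x : Fin n ⊕ Fin n) :
    doubleRec f g (minusPt x) = f x := by
  have h := (eq_minusPt_or_plusPt (minusPt x)).choose_spec
  rcases h with h | h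
  · rw [doubleRec, if_pos h, ← minusPt_injective h]
  · exact (minusPt_ne_plusPt _ _ h).elim

theorem doubleRec_plusPt {T : Type} (f g : Fin n ⊕ Fin n → T) (x : Fin n ⊕ Fin n) :
    doubleRec f g (plusPt x) = g x := by
  have h := (eq_minusPt_or_plusPt (plusPt x)).choose_spec
  rcases h with h | h
  · exact (minusPt_ne_plusPt _ _ h.symm).elim
  · rw [doubleRec, if_neg fun h => minusPt_ne_plusPt _ _ h.symm, ← plusPt_injective h]

/-- The matching of the doubled strip that joins the second copy of `x` to the first copy of
`π x`. -/
noncomputable def pairing (π : Perm (Fin n ⊕ Fin n)) : Setoid (Fin (2 * n) ⊕ Fin (2 * n)) :=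
  Setoid.ker (doubleRec id π)

theorem pairing_minus_minus (π : Perm (Fin n ⊕ Fin n)) (x y : Fin n ⊕ Fin n) :
    (pairing π) (minusPt x) (minusPt y) ↔ x = y := by
  rw [pairing, Setoid.ker_def, doubleRec_minusPt, doubleRec_minusPt]; rfl

theorem pairing_plus_plus (π : Perm (Fin n ⊕ Fin n)) (x y : Fin n ⊕ Fin n) :
    (pairing π) (plusPt x) (plusPt y) ↔ x = y := by
  rw [pairing, Setoid.ker_def, doubleRec_plusPt, doubleRec_plusPt, π.injective.eq_iff]

theorem pairing_plus_minus (π : Perm (Fin n ⊕ Fin n)) (x y : Fin n ⊕ Fin n) :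
    (pairing π) (plusPt x) (minusPt y) ↔ π x = y := by
  rw [pairing, Setoid.ker_def, doubleRec_plusPt, doubleRec_minusPt]; rfl

theorem pairing_minus_plus (π : Perm (Fin n ⊕ Fin n)) (x y : Fin n ⊕ Fin n) :
    (pairing π) (minusPt x) (plusPt y) ↔ π y = x := by
  rw [pairing, Setoid.ker_def, doubleRec_plusPt, doubleRec_minusPt]; exact eq_comm

theorem pairing_apply (π : Perm (Fin n ⊕ Fin n)) (x : Fin n ⊕ Fin n) :
    (pairing π) (plusPt x) (minusPt (π x)) := (pairing_plus_minus π _ _).2 rfl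

theorem pairing_injective : Function.Injective (pairing (n := n)) := fun π π' h =>
  Perm.ext fun x => by
    have := pairing_apply π x
    rw [h, pairing_plus_minus] at this
    exact this.symm

theorem pairing_isMatching (π : Perm (Fin n ⊕ Fin n)) : IsMatching (pairing π) := by
  intro p
  obtain ⟨x, rfl | rfl⟩ := eq_minusPt_or_plusPt p
  · refine ⟨plusPt (π⁻¹ x), ⟨(minusPt_ne_plusPt _ _).symm, ?_⟩, ?_⟩
    · rw [pairing_minus_plus]; exact π.apply_symm_apply x
    · rintro q ⟨hq, h⟩
      obtain ⟨y, rfl | rfl⟩ := eq_minusPt_or_plusPt q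
      · rw [pairing_minus_minus] at h
        exact (hq (h ▸ rfl)).elim
      · rw [pairing_minus_plus] at h
        rw [← h, Perm.inv_def, Equiv.symm_apply_apply]
  · refine ⟨minusPt (π x), ⟨minusPt_ne_plusPt _ _, pairing_apply π x⟩, ?_⟩
    rintro q ⟨hq, h⟩
    obtain ⟨y, rfl | rfl⟩ := eq_minusPt_or_plusPt q
    · rw [pairing_plus_minus] at h
      rw [h]
    · rw [pairing_plus_plus] at h
      exact (hq (h ▸ rfl)).elim

/-- The gap between a point and its successor contains no point of their block and respects every
other block, so a curve starting at another point has both ends inside the gap or both outside. -/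
theorem IsPlanar.pairing {a : Setoid (Fin n ⊕ Fin n)} (ha : IsPlanar a) :
    IsPlanar (CyclicDiagram.pairing (next a)) := by
  have key : ∀ x w : Fin n ⊕ Fin n, x ≠ w →
      (Arc x (next a x) w ↔ Arc x (next a x) (next a w)) := by
    intro x w hxw
    by_cases h : a x w
    · exact iff_of_false (fun h' => (next_isNext a x).2 w h' h)
        (fun h' => (next_isNext a x).2 _ h' (a.trans h (next_rel a w)))
    · exact ⟨ha.arc (next_rel a x) (next_rel a w) h,
        ha.arc (next_rel a x) (a.symm (next_rel a w)) fun h' =>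
          h (a.trans h' (a.symm (next_rel a w)))⟩
  intro p q r s h₁ h₂ h₃ hpr hqs
  obtain ⟨x, rfl | rfl⟩ := eq_minusPt_or_plusPt p <;>
    obtain ⟨y, rfl | rfl⟩ := eq_minusPt_or_plusPt q <;>
    obtain ⟨z, rfl | rfl⟩ := eq_minusPt_or_plusPt r <;>
    obtain ⟨w, rfl | rfl⟩ := eq_minusPt_or_plusPt s <;>
    simp only [pos_minusPt, pos_plusPt] at h₁ h₂ h₃ <;>
    simp only [pairing_minus_minus, pairing_minus_plus, pairing_plus_minus,
      pairing_plus_plus] at hpr hqs <;> subst hpr <;> subst hqs <;>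
    exfalso <;>
    -- The four calls to `key` cover the possible choices of the source end on each of the two
    -- crossing curves.
    first
    | omega
    | (have := key x y (by rintro rfl; omega); simp only [Arc] at this; omega)
    | (have := key x w (by rintro rfl; omega); simp only [Arc] at this; omega)
    | (have := key z y (by rintro rfl; omega); simp only [Arc] at this; omega)
    | (have := key z w (by rintro rfl; omega); simp only [Arc] at this; omega)

/-- In a matching each point has only one possible partner, so equalities of matchings reduce to one
inclusion. -/
theorem IsMatching.eq_of_le {r : Setoid (Fin n ⊕ Fin n)} {q : Setoid (Fin n ⊕ Fin n)}
    (hr : IsMatching r) (hq : IsMatching q) (h : r ≤ q) : r = q := by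
  refine le_antisymm h fun x y hxy => ?_
  obtain ⟨z, ⟨hz, hxz⟩, -⟩ := hr x
  by_cases hyx : y = x
  · rw [hyx]
  · rw [(hq x).unique ⟨hyx, hxy⟩ ⟨hz, h hxz⟩]
    exact hxz

theorem pairing_le_iff {π : Perm (Fin n ⊕ Fin n)} {r : Setoid (Fin (2 * n) ⊕ Fin (2 * n))} :
    CyclicDiagram.pairing π ≤ r ↔ ∀ x, r (plusPt x) (minusPt (π x)) := by
  refine ⟨fun h x => h (pairing_apply π x), fun h p q hpq => ?_⟩
  obtain ⟨x, rfl | rfl⟩ := eq_minusPt_or_plusPt p <;>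
    obtain ⟨y, rfl | rfl⟩ := eq_minusPt_or_plusPt q
  · rw [(pairing_minus_minus π x y).1 hpq]
  · rw [← (pairing_minus_plus π x y).1 hpq]; exact r.symm (h y)
  · rw [← (pairing_plus_minus π x y).1 hpq]; exact h x
  · rw [(pairing_plus_plus π x y).1 hpq]

/-- A planar matching of the doubled strip is the pairing of a planar partition. -/
theorem eq_pairing_next {M : Setoid (Fin (2 * n) ⊕ Fin (2 * n))} (hM : IsPlanar M)
    (hM' : IsMatching M) {ρ : Fin n ⊕ Fin n → Fin n ⊕ Fin n}
    (hρ : ∀ x, M (plusPt x) (minusPt (ρ x))) {a : Setoid (Fin n ⊕ Fin n)} (ha : ∀ x, a x (ρ x))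
    (ha' : ∀ S : Set (Fin n ⊕ Fin n), (∀ x ∈ S, ρ x ∈ S) → ∀ x y, a x y → x ∈ S → y ∈ S) :
    M = CyclicDiagram.pairing (next a) := by
  have hnc : ∀ x w, x ≠ w → ¬ M (plusPt x) (plusPt w) := by
    intro x w hxw h
    have := (hM' (plusPt x)).unique ⟨(minusPt_ne_plusPt _ _), hρ x⟩
      ⟨fun h => hxw (plusPt_injective h).symm, h⟩
    exact minusPt_ne_plusPt _ _ this
  have c : ∀ p q r s, M p r → M q s → ¬ M p q →
      ¬ (pos p < pos q ∧ pos q < pos r ∧ pos r < pos s) :=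
    fun p q r s h₁ h₂ h₃ h => h₃ (hM p q r s h.1 h.2.1 h.2.2 h₁ h₂)
  -- The curve leaving `w` cannot cross the curve from `x` to `ρ x`, so the gap after `x` is closed
  -- under `ρ`.
  have key : ∀ x w, Arc x (ρ x) w → Arc x (ρ x) (ρ w) := by
    intro x w h
    have hxw : x ≠ w := by
      rintro rfl
      simp only [Arc] at h
      omega
    have h₁ := M.symm (hρ x)
    have h₂ := M.symm (hρ w)
    have h₃ := hnc x w hxw
    have h₄ : ¬ M (minusPt (ρ x)) (plusPt w) := fun h' => h₃ (M.trans (hρ x) h')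
    have h₅ : ¬ M (plusPt x) (minusPt (ρ w)) := fun h' => h₃ (M.trans h' h₂)
    have h₆ : ¬ M (minusPt (ρ x)) (minusPt (ρ w)) := fun h' => h₅ (M.trans (hρ x) h')
    have n₁ : pos (ρ x) ≠ pos (ρ w) := pos_ne fun h' => h₆ (h' ▸ M.refl _)
    have c₁ := c _ _ _ _ (hρ x) (hρ w) h₃
    have c₂ := c _ _ _ _ h₁ h₂ h₆
    have c₃ := c _ _ _ _ (hρ w) h₁ fun h' => h₄ (M.symm h')
    have c₄ := c _ _ _ _ h₂ (hρ x) fun h' => h₅ (M.symm h')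
    clear c
    simp only [pos_minusPt, pos_plusPt] at c₁ c₂ c₃ c₄
    simp only [Arc] at h ⊢
    rcases h with h | ⟨h, h | h⟩
    · left; omega
    · right; omega
    · right; omega
  refine ((pairing_isMatching (next a)).eq_of_le hM' (pairing_le_iff.2 fun x => ?_)).symm
  suffices h : next a x = ρ x by rw [h]; exact hρ x
  refine next_eq_iff.2 ⟨ha x, fun z hz hxz => ?_⟩
  -- A point `z` of the block of `x` in this gap would put `x` itself in the gap, since `ρ`-closed
  -- sets are unions of blocks.
  have := ha' {w | Arc x (ρ x) w} (key x) z x (a.symm hxz) hz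
  change Arc x (ρ x) x at this
  simp only [Arc] at this
  omega

end Next
-- Transpositions transported along an embedding
section MapPairs

variable {P U : Type} [DecidableEq P] [DecidableEq U] (e : P ↪ U)

/-- The image of a list of pairs under an embedding. -/
def mapPairs (l : List (P × P)) : List (U × U) := l.map (Prod.map e e)

theorem viaEmbedding_swap (s t : P) : (swap s t).viaEmbedding e = swap (e s) (e t) := by
  ext x
  by_cases hx : x ∈ Set.range e
  · obtain ⟨p, rfl⟩ := hx
    rw [Perm.viaEmbedding_apply, e.swap_apply]
  · rw [Perm.viaEmbedding_apply_of_notMem _ _ _ hx, swap_apply_of_ne_of_ne]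
    · rintro rfl; exact hx ⟨s, rfl⟩
    · rintro rfl; exact hx ⟨t, rfl⟩

theorem swapProd_mapPairs (l : List (P × P)) :
    swapProd (mapPairs e l) = (swapProd l).viaEmbedding e := by
  induction l with
  | nil => exact (map_one (Perm.viaEmbeddingHom e)).symm
  | cons p l ih =>
    change swapProd ((e p.1, e p.2) :: mapPairs e l) = _
    rw [swapProd_cons, swapProd_cons, ih, ← viaEmbedding_swap]
    exact (map_mul (Perm.viaEmbeddingHom e) _ _).symm

end MapPairs

/-! ### Genus zero and Euler's formula for stacked planar diagrams -/

section Stack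

variable {n : ℕ}

theorem conn_mapPairs_le_iff {P U : Type} {e : P ↪ U} {l : List (P × P)} {r : Setoid U} :
    conn (mapPairs e l) ≤ r ↔ conn l ≤ r.comap e := by
  rw [conn_le_iff, conn_le_iff, mapPairs, List.forall_mem_map]
  rfl

/-- The embedding of the upper diagram into the stacked diagram. -/
def upperEmb : Fin n ⊕ Fin n ↪ Fin n ⊕ Fin n ⊕ Fin n :=
  ⟨upperPt, Function.injective_id.sumMap Sum.inl_injective⟩

/-- The embedding of the lower diagram into the stacked diagram. -/
def lowerEmb : Fin n ⊕ Fin n ↪ Fin n ⊕ Fin n ⊕ Fin n := ⟨Sum.inr, Sum.inr_injective⟩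

/-- The permutation of the three rows that follows the upper permutation and then the lower one. -/
noncomputable def stack (π ρ : Perm (Fin n ⊕ Fin n)) : Perm (Fin n ⊕ Fin n ⊕ Fin n) :=
  ρ.viaEmbedding lowerEmb * π.viaEmbedding upperEmb

theorem outerPt_injective :
    Function.Injective (outerPt : Fin n ⊕ Fin n → Fin n ⊕ Fin n ⊕ Fin n) :=
  Function.injective_id.sumMap Sum.inr_injective

theorem upper_apply (π : Perm (Fin n ⊕ Fin n)) (p : Fin n ⊕ Fin n) :
    π.viaEmbedding upperEmb (upperPt p : Fin n ⊕ Fin n ⊕ Fin n) = upperPt (π p) :=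
  Perm.viaEmbedding_apply π upperEmb p

theorem upper_apply_bottom (π : Perm (Fin n ⊕ Fin n)) (z : Fin n) :
    π.viaEmbedding upperEmb (.inr (.inr z) : Fin n ⊕ Fin n ⊕ Fin n) = .inr (.inr z) := by
  refine Perm.viaEmbedding_apply_of_notMem _ _ _ ?_
  rintro ⟨p | p, h⟩ <;> simp [upperEmb, upperPt] at h

theorem lower_apply (π : Perm (Fin n ⊕ Fin n)) (p : Fin n ⊕ Fin n) :
    π.viaEmbedding lowerEmb (.inr p : Fin n ⊕ Fin n ⊕ Fin n) = .inr (π p) :=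
  Perm.viaEmbedding_apply π lowerEmb p

theorem lower_apply_top (π : Perm (Fin n ⊕ Fin n)) (x : Fin n) :
    π.viaEmbedding lowerEmb (.inl x : Fin n ⊕ Fin n ⊕ Fin n) = .inl x := by
  refine Perm.viaEmbedding_apply_of_notMem _ _ _ ?_
  rintro ⟨p | p, h⟩ <;> simp [lowerEmb] at h

/-- The pairs of two lists, placed in the lower and in the upper part of the stacked diagram. -/
def stackPairs (l l' : List ((Fin n ⊕ Fin n) × (Fin n ⊕ Fin n))) :
    List ((Fin n ⊕ Fin n ⊕ Fin n) × (Fin n ⊕ Fin n ⊕ Fin n)) :=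
  mapPairs lowerEmb l' ++ mapPairs upperEmb l

theorem swapProd_stackPairs (l l' : List ((Fin n ⊕ Fin n) × (Fin n ⊕ Fin n))) :
    swapProd (stackPairs l l') = stack (swapProd l) (swapProd l') := by
  rw [stackPairs, swapProd_append, swapProd_mapPairs, swapProd_mapPairs, stack]

/-- Both sides are the least partition whose restrictions to the two layers contain the given ones.
-/
theorem conn_stackPairs (l l' : List ((Fin n ⊕ Fin n) × (Fin n ⊕ Fin n))) :
    conn (stackPairs l l') = glue (conn l) (conn l') := by
  have happ : ∀ r, conn (stackPairs l l') ≤ r ↔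
      conn l ≤ r.comap upperEmb ∧ conn l' ≤ r.comap lowerEmb := by
    intro r
    rw [← conn_mapPairs_le_iff, ← conn_mapPairs_le_iff, conn_le_iff, conn_le_iff, conn_le_iff,
      stackPairs]
    simp only [List.mem_append]
    exact ⟨fun h => ⟨fun p hp => h p (.inr hp), fun p hp => h p (.inl hp)⟩,
      fun h p hp => hp.elim (h.2 p) (h.1 p)⟩
  refine le_antisymm ((happ _).2 ⟨fun p q h => .rel _ _ (.upper h),
    fun p q h => .rel _ _ (.lower h)⟩) ?_
  obtain ⟨h₁, h₂⟩ := (happ _).1 le_rfl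
  refine Setoid.eqvGen_le ?_
  rintro _ _ (h | h)
  · exact h₁ h
  · exact h₂ h

theorem next_top {p q : Fin n ⊕ Fin n}
    (h : pos q = pos p + 1 ∨ (pos p = 2 * n - 1 ∧ pos q = 0)) : next ⊤ p = q := by
  refine next_eq_iff.2 ⟨trivial, fun z hz => ?_⟩
  have := pos_nonneg z
  have := pos_lt z
  simp only [Arc] at hz
  omega

/-- The upper layer traverses the middle row backwards and the lower one forwards, so a step to `i -
1` is undone. -/
theorem stack_top_middle {i : Fin n} (hi : 0 < i.val) :
    stack (next ⊤) (next ⊤) (.inr (.inl i)) = .inr (.inl i) := by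
  have h₁ : next ⊤ (.inr i : Fin n ⊕ Fin n) = .inr ⟨i - 1, by omega⟩ :=
    next_top (.inl (by simp only [pos]; omega))
  have h₂ : next ⊤ (.inl ⟨i - 1, by omega⟩ : Fin n ⊕ Fin n) = .inl i :=
    next_top (.inl (by simp only [pos]; omega))
  have := upper_apply (next ⊤) (.inr i)
  rw [h₁] at this
  rw [stack, Perm.mul_apply]
  exact (congrArg _ this).trans ((lower_apply _ _).trans (congrArg _ h₂))

theorem stack_top_outer (hn : 0 < n) (p : Fin n ⊕ Fin n) :
    (stack (next ⊤) (next ⊤)).SameCycle (.inr (.inl ⟨0, hn⟩)) (outerPt p) := by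
  have step : ∀ {u v : Fin n ⊕ Fin n ⊕ Fin n}, stack (next ⊤) (next ⊤) u = v →
      (stack (next ⊤) (next ⊤)).SameCycle u v := by
    rintro u v rfl
    exact cycles_self _ u
  rcases p with ⟨k, hk⟩ | ⟨k, hk⟩
  · induction k with
    | zero =>
      apply step
      have h : next ⊤ (.inr ⟨0, hn⟩ : Fin n ⊕ Fin n) = .inl ⟨0, hn⟩ :=
        next_top (.inr (by simp [pos]))
      have := upper_apply (next ⊤) (.inr ⟨0, hn⟩)
      rw [h] at this
      rw [stack, Perm.mul_apply]
      exact (congrArg _ this).trans (lower_apply_top _ _)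
    | succ k ih =>
      refine (ih (by omega)).trans (step ?_)
      have h : next ⊤ (.inl ⟨k, Nat.lt_of_succ_lt hk⟩ : Fin n ⊕ Fin n) = .inl ⟨k + 1, hk⟩ :=
        next_top (.inl (by simp [pos]))
      have := upper_apply (next ⊤) (.inl ⟨k, Nat.lt_of_succ_lt hk⟩)
      rw [h] at this
      rw [stack, Perm.mul_apply]
      exact (congrArg _ this).trans (lower_apply_top _ _)
  · induction k with
    | zero =>
      refine (step ?_).symm
      have h : next ⊤ (.inr ⟨0, hn⟩ : Fin n ⊕ Fin n) = .inl ⟨0, hn⟩ :=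
        next_top (.inr (by simp [pos]))
      rw [stack, Perm.mul_apply]
      exact (congrArg _ (upper_apply_bottom _ _)).trans ((lower_apply _ _).trans (congrArg _ h))
    | succ k ih =>
      refine (ih (by omega)).trans (step ?_).symm
      have h : next ⊤ (.inr ⟨k + 1, hk⟩ : Fin n ⊕ Fin n) = .inr ⟨k, by omega⟩ :=
        next_top (.inl (by simp only [pos]; push_cast; ring))
      rw [stack, Perm.mul_apply]
      exact (congrArg _ (upper_apply_bottom _ _)).trans ((lower_apply _ _).trans (congrArg _ h))

/-- The middle points lie on distinct cycles: all but the first are fixed. -/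
theorem le_cycleCount_stack_top : n ≤ cycleCount (stack (next (n := n) ⊤) (next ⊤)) := by
  have key : ∀ i j : Fin n, 0 < i.val →
      (stack (next ⊤) (next ⊤)).SameCycle (.inr (.inl i)) (.inr (.inl j)) → i = j := by
    intro i j hi h
    have := mem_of_sameCycle (S := {(.inr (.inl i) : Fin n ⊕ Fin n ⊕ Fin n)}) (by
      rintro _ rfl
      exact stack_top_middle hi) h rfl
    simpa using this.symm
  have := Nat.card_le_card_of_injective
    (fun i : Fin n => Quotient.mk (cycles (stack (next ⊤) (next ⊤))) (.inr (.inl i))) (by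
      intro i j h
      have h := Quotient.exact h
      by_cases hi : 0 < i.val
      · exact key i j hi h
      · by_cases hj : 0 < j.val
        · exact (key j i hj (Setoid.symm' _ h)).symm
        · exact Fin.ext (by omega))
  rwa [Nat.card_fin] at this

/-- Following the whole strip in both layers is a configuration of genus zero, and it remains one
when two outer points are swapped. -/
theorem genus_stackPairs_top (hn : 0 < n) {l l' : List ((Fin n ⊕ Fin n) × (Fin n ⊕ Fin n))}
    (h : swapProd l = next ⊤) (h' : swapProd l' = next ⊤) (hl : l.length ≤ 2 * n - 1)
    (hl' : l'.length ≤ 2 * n - 1) :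
    genus (stackPairs l l') ≤ 0 ∧ ∀ p q : Fin n ⊕ Fin n, p ≠ q →
      genus ((outerPt p, outerPt q) :: stackPairs l l') ≤ 0 := by
  have hcard : Nat.card (Fin n ⊕ Fin n ⊕ Fin n) = 3 * n := by
    rw [Nat.card_sum, Nat.card_sum, Nat.card_fin]; ring
  have hlen : (stackPairs l l').length = l'.length + l.length := by
    simp [stackPairs, mapPairs]
  have hc : conn l = ⊤ := top_le_iff.1 (by
    rw [← cycles_next ⊤, ← h]; exact cycles_swapProd_le l)
  have hc' : conn l' = ⊤ := top_le_iff.1 (by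
    rw [← cycles_next ⊤, ← h']; exact cycles_swapProd_le l')
  have hconn : conn (stackPairs l l') = ⊤ := by
    rw [conn_stackPairs, hc, hc']
    have key : ∀ u, (glue (⊤ : Setoid (Fin n ⊕ Fin n)) (⊤ : Setoid (Fin n ⊕ Fin n))) u (Sum.inr (Sum.inl ⟨0, hn⟩) : Fin n ⊕ Fin n ⊕ Fin n) := by
      rintro (x | y)
      · exact .rel _ _ (.upper (p := .inl x) (q := (.inr ⟨0, hn⟩ : Fin n ⊕ Fin n)) trivial)
      · exact .rel _ _ (.lower (p := y) (q := (.inl ⟨0, hn⟩ : Fin n ⊕ Fin n)) trivial)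
    exact top_le_iff.1 fun u v _ => Setoid.trans' _ (key u) (Setoid.symm' _ (key v))
  have hsub : Subsingleton (Quotient (⊤ : Setoid (Fin n ⊕ Fin n ⊕ Fin n))) :=
    ⟨fun C D => Quotient.inductionOn₂ C D fun _ _ => Quotient.sound trivial⟩
  have hblocks : blocks (⊤ : Setoid (Fin n ⊕ Fin n ⊕ Fin n)) ≤ 1 :=
    Finite.card_le_one_iff_subsingleton.2 hsub
  have hcount := le_cycleCount_stack_top (n := n)
  refine ⟨?_, fun p q hpq => ?_⟩
  -- With `3 * n` points, at least `n` cycles and one component, the bound is `(4 * n - 2) + (3 * n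
  -- - n) - 2 * (3 * n - 1) = 0`.
  · rw [genus, swapProd_stackPairs, h, h', hconn, hcard, hlen]
    omega
  · have hcons : conn ((outerPt p, outerPt q) :: stackPairs l l') = ⊤ :=
      top_le_iff.1 (hconn ▸ le_merge _ _ _)
    -- All outer points lie on one cycle, so swapping two of them splits it, and the extra cycle
    -- pays for the extra transposition.
    have hlt := lt_cycleCount_swap_mul
      (outerPt_injective.ne hpq)
      ((stack_top_outer hn p).symm.trans (stack_top_outer hn q))
    rw [genus, swapProd_cons, swapProd_stackPairs, h, h', hcons, hcard, List.length_cons, hlen]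
    simp only
    omega

/-- A shortest factorisation of `next a` is extended by the Kreweras complement to a factorisation
of the full cycle. -/
theorem IsPlanar.exists_pairs {a : Setoid (Fin n ⊕ Fin n)} (ha : IsPlanar a) :
    ∃ l k : List ((Fin n ⊕ Fin n) × (Fin n ⊕ Fin n)), swapProd l = next a ∧ conn l = a ∧
      l.length + blocks a = 2 * n ∧ swapProd (k ++ l) = next ⊤ ∧
      k.length ≤ blocks a - 1 := by
  obtain ⟨l, h₁, h₂, h₃⟩ := exists_swapProd_eq (next a)
  obtain ⟨k, h₄, h₅⟩ := ha.exists_complement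
  have hcard : Nat.card (Fin n ⊕ Fin n) = 2 * n := by
    rw [Nat.card_sum, Nat.card_fin]; ring
  rw [cycles_next] at h₂
  rw [cycleCount, cycles_next, hcard] at h₃
  have h₆ := card_le_blocks_conn l
  rw [h₂, hcard] at h₆
  exact ⟨l, k, h₁, h₂, by omega, by rw [swapProd_append, h₁, h₄], h₅⟩

theorem cycles_stack_le (a b : Setoid (Fin n ⊕ Fin n)) :
    cycles (stack (next a) (next b)) ≤ glue a b := by
  obtain ⟨l, h₁, h₂, -⟩ := exists_swapProd_eq (next a)
  obtain ⟨l', h₁', h₂', -⟩ := exists_swapProd_eq (next b)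
  rw [cycles_next] at h₂ h₂'
  have := cycles_swapProd_le (stackPairs l l')
  rwa [swapProd_stackPairs, conn_stackPairs, h₁, h₁', h₂, h₂'] at this

theorem sublist_stackPairs (l k l' k' : List ((Fin n ⊕ Fin n) × (Fin n ⊕ Fin n))) :
    (stackPairs l l').Sublist (stackPairs (k ++ l) (k' ++ l')) :=
  ((List.sublist_append_right _ _).map _).append ((List.sublist_append_right _ _).map _)

/-- Outer points of one component of a stack of planar diagrams are met by one boundary walk. -/
theorem IsPlanar.sameCycle_stack {a b : Setoid (Fin n ⊕ Fin n)} (ha : IsPlanar a)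
    (hb : IsPlanar b) {p q : Fin n ⊕ Fin n} (h : (glue a b) (outerPt p) (outerPt q)) :
    (stack (next a) (next b)).SameCycle (outerPt p) (outerPt q) := by
  rcases eq_or_ne p q with rfl | hpq
  · exact Perm.SameCycle.refl _ _
  have hpos : ∀ c : Setoid (Fin n ⊕ Fin n), 0 < blocks c := fun c =>
    Nat.card_pos_iff.2 ⟨⟨Quotient.mk _ p⟩, inferInstance⟩
  have hn : 0 < n := by
    have := pos_nonneg p
    have := pos_lt p
    omega
  obtain ⟨l, k, h₁, h₂, h₃, h₄, h₅⟩ := ha.exists_pairs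
  obtain ⟨l', k', h₁', h₂', h₃', h₄', h₅'⟩ := hb.exists_pairs
  have hpa := hpos a
  have hpb := hpos b
  have hg := (genus_stackPairs_top hn h₄ h₄' (by rw [List.length_append]; omega)
    (by rw [List.length_append]; omega)).2 p q hpq
  -- Adding the transposition of the two outer points keeps the genus at most zero, by comparison
  -- with the full cycles, so it must split a cycle.
  have := sameCycle_of_genus_le (((genus_le_of_sublist
    ((sublist_stackPairs l k l' k').cons_cons (outerPt p, outerPt q))).trans hg).trans
      (genus_nonneg _)) (by rwa [conn_stackPairs, h₂, h₂'])
  rwa [swapProd_stackPairs, h₁, h₁'] at this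

/-- Euler's formula for a stack of two planar diagrams. -/
theorem IsPlanar.euler {a b : Setoid (Fin n ⊕ Fin n)} (ha : IsPlanar a) (hb : IsPlanar b) :
    (n : ℤ) + 2 * blocks (glue a b) =
      blocks a + blocks b + cycleCount (stack (next a) (next b)) := by
  obtain ⟨l, k, h₁, h₂, h₃, h₄, h₅⟩ := ha.exists_pairs
  obtain ⟨l', k', h₁', h₂', h₃', h₄', h₅'⟩ := hb.exists_pairs
  have hcard : Nat.card (Fin n ⊕ Fin n ⊕ Fin n) = 3 * n := by
    rw [Nat.card_sum, Nat.card_sum, Nat.card_fin]; ring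
  rcases Nat.eq_zero_or_pos n with hn | hn
  · have e₁ := blocks_le_card (glue a b)
    have e₂ := blocks_le_card (cycles (stack (next a) (next b)))
    rw [← cycleCount] at e₂
    omega
  have hpos : ∀ c : Setoid (Fin n ⊕ Fin n), 0 < blocks c := fun c =>
    Nat.card_pos_iff.2 ⟨⟨Quotient.mk _ (.inl ⟨0, hn⟩)⟩, inferInstance⟩
  have hpa := hpos a
  have hpb := hpos b
  have hg := (genus_le_of_sublist (sublist_stackPairs l k l' k')).trans
    (genus_stackPairs_top hn h₄ h₄' (by rw [List.length_append]; omega)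
      (by rw [List.length_append]; omega)).1
  have hg' := genus_nonneg (stackPairs l l')
  have hlen : (stackPairs l l').length = l'.length + l.length := by
    simp [stackPairs, mapPairs]
  -- The genus is squeezed to zero; with lengths `2 * n - blocks a` and `2 * n - blocks b` this is
  -- Euler's formula.
  rw [genus, swapProd_stackPairs, conn_stackPairs, h₁, h₁', h₂, h₂', hcard, hlen] at hg hg'
  omega

end Stack
-- Boundary walks and curves in the doubled stack
section Walk

variable {n : ℕ}

/-- The point of the doubled stacked strip at which the boundary walk leaves `u`. -/
def startPt : Fin n ⊕ Fin n ⊕ Fin n → Fin (2 * n) ⊕ Fin (2 * n) ⊕ Fin (2 * n)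
  | .inl x => upperPt (plusPt (.inl x))
  | .inr (.inl y) => .inr (minusPt (.inl y))
  | .inr (.inr z) => .inr (plusPt (.inr z))

/-- The point of the doubled stacked strip at which the boundary walk reaches `u`. -/
def endPt : Fin n ⊕ Fin n ⊕ Fin n → Fin (2 * n) ⊕ Fin (2 * n) ⊕ Fin (2 * n)
  | .inl x => upperPt (minusPt (.inl x))
  | .inr p => .inr (minusPt p)

theorem startPt_outerPt (p : Fin n ⊕ Fin n) : startPt (outerPt p) = outerPt (plusPt p) := by
  rcases p with p | p <;> rfl

theorem endPt_outerPt (p : Fin n ⊕ Fin n) : endPt (outerPt p) = outerPt (minusPt p) := by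
  rcases p with p | p <;> rfl

/-- The two layers run along the middle row in opposite directions, so gluing identifies the second
copy of a point of the upper layer with the first copy of its partner in the lower layer. -/
theorem startPt_upperPt (p : Fin n ⊕ Fin n) : startPt (upperPt p) = upperPt (plusPt p) := by
  rcases p with p | p <;> rfl

/-- Consecutive pieces of a boundary walk join up at middle points; the curve is interrupted only at
outer points. -/
theorem startPt_eq_endPt_or (u : Fin n ⊕ Fin n ⊕ Fin n) :
    startPt u = endPt u ∨ ∃ p, u = outerPt p := by
  rcases u with x | y | z
  · exact .inr ⟨.inl x, rfl⟩
  · exact .inl rfl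
  · exact .inr ⟨.inr z, rfl⟩

theorem glue_pairing_upper (π ρ : Perm (Fin n ⊕ Fin n)) (q : Fin n ⊕ Fin n) :
    (glue (pairing π) (pairing ρ)) (upperPt (minusPt q))
      (endPt (ρ.viaEmbedding lowerEmb (upperPt q))) := by
  rcases q with x | y
  · change (glue _ _) _ (endPt (ρ.viaEmbedding lowerEmb (.inl x)))
    rw [lower_apply_top]
    exact Setoid.refl' _ _
  · change (glue _ _) _ (endPt (ρ.viaEmbedding lowerEmb (.inr (.inl y))))
    rw [lower_apply]
    exact .rel _ _ (.lower (pairing_apply ρ (.inl y)))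

/-- Stacked pairings contain the boundary walk of the stack. -/
theorem glue_pairing_walk (π ρ : Perm (Fin n ⊕ Fin n)) (u : Fin n ⊕ Fin n ⊕ Fin n) :
    (glue (pairing π) (pairing ρ)) (startPt u) (endPt (stack π ρ u)) := by
  have key : ∀ p, (glue (pairing π) (pairing ρ)) (startPt (upperPt p))
      (endPt (stack π ρ (upperPt p))) := by
    intro p
    rw [stack, Perm.mul_apply, upper_apply, startPt_upperPt]
    exact Setoid.trans' _ (.rel _ _ (.upper (pairing_apply π p))) (glue_pairing_upper π ρ (π p))
  rcases u with x | y | z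
  · exact key (.inl x)
  · exact key (.inr y)
  · rw [stack, Perm.mul_apply, upper_apply_bottom, lower_apply]
    exact .rel _ _ (.lower (pairing_apply ρ (.inr z)))

/-- This is the first return to the outer rows, which happens because `σ` has finite order. -/
theorem exists_pow_outerPt (σ : Perm (Fin n ⊕ Fin n ⊕ Fin n)) (p : Fin n ⊕ Fin n) :
    ∃ q, ∃ k : ℕ, (σ ^ (k + 1)) (outerPt p) = outerPt q ∧
      ∀ j < k, ∀ r, (σ ^ (j + 1)) (outerPt p) ≠ outerPt r := by
  classical
  have h : ∃ k : ℕ, ∃ q, (σ ^ (k + 1)) (outerPt p) = outerPt q := by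
    obtain ⟨m, hm, hm'⟩ := isOfFinOrder_iff_pow_eq_one.1 (isOfFinOrder_of_finite σ)
    exact ⟨m - 1, p, by rw [Nat.sub_add_cancel hm, hm']; rfl⟩
  obtain ⟨q, hq⟩ := Nat.find_spec h
  exact ⟨q, Nat.find h, hq, fun j hj r hr => Nat.find_min h hj ⟨r, hr⟩⟩

theorem IsPlanar.comap_cycles_stack {a b : Setoid (Fin n ⊕ Fin n)} (ha : IsPlanar a)
    (hb : IsPlanar b) : (cycles (stack (next a) (next b))).comap outerPt = CyclicDiagram.comp a b :=
  Setoid.ext fun _ _ => ⟨fun h => cycles_stack_le a b h, fun h => ha.sameCycle_stack hb h⟩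

/-- Doubling planar partitions is compatible with stacking. -/
theorem IsPlanar.comp_pairing {a b : Setoid (Fin n ⊕ Fin n)} (ha : IsPlanar a)
    (hb : IsPlanar b) : CyclicDiagram.comp (CyclicDiagram.pairing (next a))
      (CyclicDiagram.pairing (next b)) =
      CyclicDiagram.pairing (next (CyclicDiagram.comp a b)) := by
  -- The first-return map `ρ` describes the product matching, and its orbits are the outer traces of
  -- the cycles of the stack, which are the blocks of the product. `eq_pairing_next` then identifies
  -- the matching.
  choose ρ k hk hk' using exists_pow_outerPt (stack (next a) (next b))
  refine eq_pairing_next (ha.pairing.comp hb.pairing)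
    ((pairing_isMatching _).comp (pairing_isMatching _)) (ρ := ρ) ?_ ?_ ?_
  · intro x
    have key : ∀ j ≤ k x, (glue (CyclicDiagram.pairing (next a)) (CyclicDiagram.pairing (next b)))
        (startPt (outerPt x)) (endPt ((stack (next a) (next b) ^ (j + 1)) (outerPt x))) := by
      intro j
      induction j with
      | zero => exact fun _ => glue_pairing_walk _ _ _
      | succ j ih =>
        intro hj
        refine Setoid.trans' _ (ih (by omega)) ?_
        rw [pow_succ' _ (j + 1), Perm.mul_apply]
        rcases startPt_eq_endPt_or ((stack (next a) (next b) ^ (j + 1)) (outerPt x)) with h | ⟨r, h⟩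
        · rw [← h]
          exact glue_pairing_walk _ _ _
        · exact (hk' x j (by omega) r h).elim
    have := key (k x) le_rfl
    rwa [hk, startPt_outerPt, endPt_outerPt] at this
  · intro x
    rw [← ha.comap_cycles_stack hb]
    exact ⟨(k x + 1 : ℕ), by rw [zpow_natCast, hk]⟩
  · intro S hS x y hxy hx
    rw [← ha.comap_cycles_stack hb] at hxy
    obtain ⟨m, -, hm⟩ := Perm.SameCycle.exists_pow_eq' hxy
    clear hxy
    -- A walk between outer points is cut into successive first returns.
    induction m using Nat.strong_induction_on generalizing x with
    | _ m ih =>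
    rcases Nat.eq_zero_or_pos m with rfl | hpos
    · rwa [← outerPt_injective hm]
    · rcases Nat.lt_or_ge m (k x + 1) with h | h
      · refine (hk' x (m - 1) (by omega) y ?_).elim
        rw [Nat.sub_add_cancel hpos, hm]
      · refine ih (m - (k x + 1)) (by omega) (ρ x) (hS x hx) ?_
        rw [← hk, ← Perm.mul_apply, ← pow_add, Nat.sub_add_cancel h, hm]

theorem glue_pairing_pow (π ρ : Perm (Fin n ⊕ Fin n)) {u : Fin n ⊕ Fin n ⊕ Fin n}
    (hu : ∀ e, ¬ (glue (pairing π) (pairing ρ)) (startPt u) (outerPt e)) (k : ℕ) :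
    (glue (pairing π) (pairing ρ)) (startPt u) (startPt ((stack π ρ ^ k) u)) := by
  induction k with
  | zero => exact Setoid.refl' _ _
  | succ k ih =>
    have h := Setoid.trans' _ ih (glue_pairing_walk π ρ ((stack π ρ ^ k) u))
    rw [← Perm.mul_apply, ← pow_succ'] at h
    rcases startPt_eq_endPt_or ((stack π ρ ^ (k + 1)) u) with h' | ⟨p, h'⟩
    · rwa [h']
    · rw [h', endPt_outerPt] at h
      exact (hu _ h).elim

/-- The point of the stacked strip whose boundary walk contains a point of the doubled stacked
strip. -/
noncomputable def walkPt (ρ : Perm (Fin n ⊕ Fin n)) :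
    Fin (2 * n) ⊕ Fin (2 * n) ⊕ Fin (2 * n) → Fin n ⊕ Fin n ⊕ Fin n
  | .inl x => doubleRec outerPt outerPt (.inl x)
  | .inr q => doubleRec Sum.inr
      (Sum.elim (fun y => Sum.inr (ρ (.inl y))) (fun z => Sum.inr (Sum.inr z))) q

theorem walkPt_upper_minus (ρ : Perm (Fin n ⊕ Fin n)) (q : Fin n ⊕ Fin n) :
    walkPt ρ (upperPt (minusPt q)) = ρ.viaEmbedding lowerEmb (upperPt q) := by
  rcases q with x | y
  · exact (doubleRec_minusPt _ _ (.inl x)).trans (lower_apply_top _ _).symm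
  · exact (doubleRec_plusPt _ _ (.inl y)).trans (lower_apply _ _).symm

theorem walkPt_startPt (ρ : Perm (Fin n ⊕ Fin n)) (u : Fin n ⊕ Fin n ⊕ Fin n) :
    walkPt ρ (startPt u) = u := by
  rcases u with x | y | z
  · exact doubleRec_plusPt _ _ (.inl x)
  · exact doubleRec_minusPt _ _ (.inl y)
  · exact doubleRec_plusPt _ _ (.inr z)

theorem walkPt_outerPt (ρ : Perm (Fin n ⊕ Fin n)) (e : Fin (2 * n) ⊕ Fin (2 * n)) :
    ∃ p, walkPt ρ (outerPt e) = outerPt p := by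
  obtain ⟨p, rfl | rfl⟩ := eq_minusPt_or_plusPt e
  · refine ⟨p, ?_⟩
    rcases p with x | z
    · exact doubleRec_minusPt _ _ (.inl x)
    · exact doubleRec_minusPt _ _ (.inr z)
  · refine ⟨p, ?_⟩
    rw [← startPt_outerPt, walkPt_startPt]

/-- Every curve stays on one cycle of the stack. The converse fails at outer points, where the two
copies have the same `walkPt` without being joined. -/
theorem glue_pairing_le (π ρ : Perm (Fin n ⊕ Fin n)) :
    glue (pairing π) (pairing ρ) ≤ (cycles (stack π ρ)).comap (walkPt ρ) := by
  refine Setoid.eqvGen_le ?_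
  have hup : pairing π ≤ ((cycles (stack π ρ)).comap (walkPt ρ)).comap upperPt := by
    refine pairing_le_iff.2 fun x => ?_
    change (cycles (stack π ρ)) (walkPt ρ _) (walkPt ρ _)
    rw [walkPt_upper_minus, ← startPt_upperPt, walkPt_startPt, ← upper_apply, ← Perm.mul_apply]
    exact cycles_self _ _
  have hlow : pairing ρ ≤ ((cycles (stack π ρ)).comap (walkPt ρ)).comap Sum.inr := by
    refine pairing_le_iff.2 fun x => ?_
    change (cycles (stack π ρ)) (walkPt ρ _) (walkPt ρ _)
    have h : walkPt ρ (.inr (minusPt (ρ x))) = .inr (ρ x) := doubleRec_minusPt _ _ _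
    rw [h]
    rcases x with y | z
    · have h : walkPt ρ (.inr (plusPt (.inl y))) = .inr (ρ (.inl y)) := doubleRec_plusPt _ _ _
      rw [h]
    · have h : walkPt ρ (.inr (plusPt (.inr z))) = .inr (.inr z) := doubleRec_plusPt _ _ _
      have h' : stack π ρ (.inr (.inr z)) = .inr (ρ (.inr z)) := by
        rw [stack, Perm.mul_apply, upper_apply_bottom, lower_apply]
      rw [h, ← h']
      exact cycles_self _ _
  rintro _ _ (h | h)
  · exact hup h
  · exact hlow h

/-- Away from the outer rows a boundary walk is never interrupted, so loops and cycles missing the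
outer points correspond through `walkPt` and `startPt`. -/
theorem internalCount_pairing (π ρ : Perm (Fin n ⊕ Fin n)) :
    internalCount (pairing π) (pairing ρ) = Nat.card {C : Quotient (cycles (stack π ρ)) //
      ∀ p : Fin n ⊕ Fin n, C ≠ Quotient.mk _ (outerPt p)} := by
  -- A point of a loop is in the middle row, and it is the end of a piece of walk or is joined to
  -- one by the lower matching. That end is again a start.
  have hinner : ∀ u, (∀ e, ¬ (glue (pairing π) (pairing ρ)) u (outerPt e)) →
      ∃ v, (glue (pairing π) (pairing ρ)) u (startPt v) := by
    intro u hu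
    have hend : ∀ v, (glue (pairing π) (pairing ρ)) u (endPt v) →
        ∃ v, (glue (pairing π) (pairing ρ)) u (startPt v) := by
      intro v hv
      rcases startPt_eq_endPt_or v with h | ⟨p, rfl⟩
      · exact ⟨v, h ▸ hv⟩
      · rw [endPt_outerPt] at hv
        exact (hu _ hv).elim
    rcases u with x | q
    · exact (hu (.inl x) (Setoid.refl' _ _)).elim
    · obtain ⟨p, rfl | rfl⟩ := eq_minusPt_or_plusPt q
      · exact hend (.inr p) (Setoid.refl' _ _)
      · exact hend (.inr (ρ p)) (.rel _ _ (.lower (pairing_apply ρ p)))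
  have hrel : ∀ u v, (∀ e, ¬ (glue (pairing π) (pairing ρ)) (startPt u) (outerPt e)) →
      (stack π ρ).SameCycle u v → (glue (pairing π) (pairing ρ)) (startPt u) (startPt v) := by
    intro u v hu huv
    obtain ⟨k, -, rfl⟩ := huv.exists_pow_eq'
    exact glue_pairing_pow π ρ hu k
  refine Nat.card_congr (Equiv.ofBijective (fun C => ⟨Quotient.map'
    (s₁ := glue (pairing π) (pairing ρ)) (s₂ := cycles (stack π ρ)) (walkPt ρ)
    (fun _ _ h => glue_pairing_le π ρ h) C.1, ?_⟩) ⟨?_, ?_⟩)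
  · rcases C with ⟨C, hC⟩
    induction C using Quotient.inductionOn with | _ u =>
    have hu : ∀ e, ¬ (glue (pairing π) (pairing ρ)) u (outerPt e) :=
      fun e h => hC e (Quotient.sound h)
    obtain ⟨v, hv⟩ := hinner u hu
    intro p hp
    have hp : (cycles (stack π ρ)) (walkPt ρ u) (outerPt p) := Quotient.exact hp
    have h := glue_pairing_le π ρ hv
    rw [Setoid.comap_rel, walkPt_startPt] at h
    have := hrel v (outerPt p) (fun e h' => hu e (Setoid.trans' _ hv h'))
      (Setoid.trans' _ (Setoid.symm' _ h) hp)
    rw [startPt_outerPt] at this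
    exact hu _ (Setoid.trans' _ hv this)
  · rintro ⟨C, hC⟩ ⟨D, hD⟩ hCD
    induction C using Quotient.inductionOn with | _ u =>
    induction D using Quotient.inductionOn with | _ u' =>
    have hCD : (cycles (stack π ρ)) (walkPt ρ u) (walkPt ρ u') :=
      Quotient.exact (congrArg Subtype.val hCD)
    have hu : ∀ e, ¬ (glue (pairing π) (pairing ρ)) u (outerPt e) :=
      fun e h => hC e (Quotient.sound h)
    obtain ⟨v, hv⟩ := hinner u hu
    obtain ⟨v', hv'⟩ := hinner u' fun e h => hD e (Quotient.sound h)
    have h := glue_pairing_le π ρ hv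
    have h' := glue_pairing_le π ρ hv'
    rw [Setoid.comap_rel, walkPt_startPt] at h h'
    refine Subtype.ext (Quotient.sound ?_)
    exact Setoid.trans' _ hv (Setoid.trans' _ (hrel v v'
      (fun e h' => hu e (Setoid.trans' _ hv h'))
      (Setoid.trans' _ (Setoid.symm' _ h) (Setoid.trans' _ hCD h'))) (Setoid.symm' _ hv'))
  · rintro ⟨C, hC⟩
    induction C using Quotient.inductionOn with | _ u =>
    refine ⟨⟨Quotient.mk _ (startPt u), fun e h => ?_⟩, Subtype.ext ?_⟩
    · have h := glue_pairing_le π ρ (Quotient.exact h)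
      rw [Setoid.comap_rel, walkPt_startPt] at h
      obtain ⟨p, hp⟩ := walkPt_outerPt ρ e
      exact hC p (Quotient.sound (hp ▸ h))
    · exact congrArg (Quotient.mk _) (walkPt_startPt ρ u)

/-- The number of loops created by stacking the doubled diagrams. -/
theorem IsPlanar.internalCount_pairing {a b : Setoid (Fin n ⊕ Fin n)} (ha : IsPlanar a)
    (hb : IsPlanar b) :
    (internalCount (CyclicDiagram.pairing (next a)) (CyclicDiagram.pairing (next b)) : ℤ) =
      n + 2 * internalCount a b + blocks (CyclicDiagram.comp a b) - blocks a - blocks b := by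
  -- Cycles and components are each split into internal ones and those that meet the outer rows. The
  -- latter are in both cases the blocks of the product.
  have h₁ := blocks_eq_add_comap (cycles (stack (next a) (next b)))
    (outerPt : Fin n ⊕ Fin n → Fin n ⊕ Fin n ⊕ Fin n)
  have h₂ := blocks_eq_add_comap (glue a b) (outerPt : Fin n ⊕ Fin n → Fin n ⊕ Fin n ⊕ Fin n)
  rw [ha.comap_cycles_stack hb, ← CyclicDiagram.internalCount_pairing] at h₁
  have h₃ := ha.euler hb
  change blocks _ = internalCount a b + blocks (CyclicDiagram.comp a b) at h₂
  rw [cycleCount] at h₃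
  omega

end Walk
-- Images of the generating diagrams
section Generators

variable {n : ℕ}

/-- Both sides are matchings, so it suffices to name the successor of each point and check one pair.
-/
theorem pairing_next_eq {a : Setoid (Fin n ⊕ Fin n)} {r : Setoid (Fin (2 * n) ⊕ Fin (2 * n))}
    (hr : IsMatching r) (h : ∀ x, ∃ y, IsNext a x y ∧ r (plusPt x) (minusPt y)) :
    pairing (next a) = r := by
  refine (pairing_isMatching _).eq_of_le hr (pairing_le_iff.2 fun x => ?_)
  obtain ⟨y, hy, hxy⟩ := h x
  rwa [next_eq_iff.2 hy]

theorem pairing_next_idPart : pairing (next (idPart (Fin n))) = idPart (Fin (2 * n)) := by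
  refine pairing_next_eq (idPart_matching _) ?_
  rintro (j | j)
  · refine ⟨.inr j, ⟨by rw [idPart_rel]; rfl, ?_⟩, by rw [idPart_rel]; rfl⟩
    rintro (z | z) <;> simp only [idPart_rel, Arc, pos, Sum.elim_inl, Sum.elim_inr, id] <;> omega
  · refine ⟨.inl j, ⟨by rw [idPart_rel]; rfl, ?_⟩, by rw [idPart_rel]; rfl⟩
    rintro (z | z) <;> simp only [idPart_rel, Arc, pos, Sum.elim_inl, Sum.elim_inr, id] <;> omega

theorem pairing_next_stopPart {i : ℕ} (hi : 1 ≤ i ∧ i ≤ n) :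
    pairing (next (stopPart n i)) = hookPart (2 * n) (2 * i - 1) := by
  refine pairing_next_eq (hookPart_matching _ _ (by omega)) ?_
  rintro (j | j)
  · by_cases h : j.val + 1 = i
    · refine ⟨.inl j, ⟨Setoid.refl' _ _, ?_⟩, by
        simp [hookPart_rel, plusPt, minusPt]; omega⟩
      rintro (z | z) <;> simp [stopPart_rel, Arc, pos] <;> omega
    · refine ⟨.inr j, ⟨by simp [stopPart_rel]; omega, ?_⟩, by
        simp [hookPart_rel, plusPt, minusPt]; omega⟩
      rintro (z | z) <;> simp [stopPart_rel, Arc, pos] <;> omega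
  · by_cases h : j.val + 1 = i
    · refine ⟨.inr j, ⟨Setoid.refl' _ _, ?_⟩, by
        simp [hookPart_rel, plusPt, minusPt]; omega⟩
      rintro (z | z) <;> simp [stopPart_rel, Arc, pos] <;> omega
    · refine ⟨.inl j, ⟨by simp [stopPart_rel]; omega, ?_⟩, by
        simp [hookPart_rel, plusPt, minusPt]; omega⟩
      rintro (z | z) <;> simp [stopPart_rel, Arc, pos] <;> omega

theorem pairing_next_bridgePart {i : ℕ} (hi : 1 ≤ i ∧ i < n) :
    pairing (next (bridgePart n i)) = hookPart (2 * n) (2 * i) := by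
  refine pairing_next_eq (hookPart_matching _ _ (by omega)) ?_
  rintro (j | j)
  · by_cases h : j.val + 1 = i
    · refine ⟨.inl ⟨j + 1, by omega⟩, ⟨by simp [bridgePart_rel]; omega, ?_⟩, by
        simp [hookPart_rel, plusPt, minusPt]; omega⟩
      rintro (z | z) <;> simp [bridgePart_rel, Arc, pos] <;> omega
    · refine ⟨.inr j, ⟨by simp [bridgePart_rel], ?_⟩, by
        simp [hookPart_rel, plusPt, minusPt]; omega⟩
      rintro (z | z) <;> simp [bridgePart_rel, Arc, pos] <;> omega
  · by_cases h : j.val = i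
    · refine ⟨.inr ⟨j - 1, by omega⟩, ⟨by simp [bridgePart_rel]; omega, ?_⟩, by
        simp [hookPart_rel, plusPt, minusPt]; omega⟩
      rintro (z | z) <;> simp [bridgePart_rel, Arc, pos] <;> omega
    · refine ⟨.inl j, ⟨by simp [bridgePart_rel], ?_⟩, by
        simp [hookPart_rel, plusPt, minusPt]; omega⟩
      rintro (z | z) <;> simp [bridgePart_rel, Arc, pos] <;> omega

theorem blocks_idPart : blocks (idPart (Fin n)) = n := by
  have h := Nat.card_congr (Setoid.quotientKerEquivOfSurjective
    (Sum.elim id id : Fin n ⊕ Fin n → Fin n) fun x => ⟨.inl x, rfl⟩)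
  rwa [Nat.card_fin] at h

theorem blocks_stopPart {i : ℕ} (hi : 1 ≤ i ∧ i ≤ n) : blocks (stopPart n i) = n + 1 := by
  obtain ⟨k, rfl⟩ : ∃ k, i = k + 1 := ⟨i - 1, by omega⟩
  have h : merge (stopPart n (k + 1)) (.inl ⟨k, by omega⟩) (.inr ⟨k, by omega⟩) =
      idPart (Fin n) := by
    refine Setoid.ext fun p q => ?_
    rcases p with p | p <;> rcases q with q | q <;>
      simp [merge_apply, stopPart_rel, idPart_rel] <;> omega
  rw [blocks_merge (s := .inl ⟨k, by omega⟩) (t := .inr ⟨k, by omega⟩) (by simp [stopPart_rel]), h,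
    blocks_idPart]

theorem blocks_bridgePart {i : ℕ} (hi : 1 ≤ i ∧ i < n) : blocks (bridgePart n i) + 1 = n := by
  obtain ⟨k, rfl⟩ : ∃ k, i = k + 1 := ⟨i - 1, by omega⟩
  have h : merge (idPart (Fin n)) (.inl ⟨k, by omega⟩) (.inl ⟨k + 1, by omega⟩) =
      bridgePart n (k + 1) := by
    refine Setoid.ext fun p q => ?_
    rcases p with p | p <;> rcases q with q | q <;>
      simp [merge_apply, bridgePart_rel, idPart_rel] <;> omega
  have := blocks_merge (r := idPart (Fin n)) (s := .inl ⟨k, by omega⟩) (t := .inl ⟨k + 1, by omega⟩)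
    (by simp [idPart_rel])
  rwa [h, blocks_idPart, eq_comm] at this

end Generators

/-! ### The doubling homomorphism -/

section Doubling

variable {m n : ℕ}

/-- Doubling, as a map from residues modulo `m` to residues modulo `2 * m`. -/
def residueDouble (m : ℕ) : ZMod m →+ ZMod (2 * m) :=
  ZMod.lift m ⟨zmultiplesHom (ZMod (2 * m)) 2, by
    have := ZMod.natCast_self (2 * m)
    push_cast at this
    simpa [mul_comm] using this⟩

theorem residueDouble_intCast (k : ℤ) : residueDouble m k = 2 * k := by
  simp [residueDouble, mul_comm]

theorem residueDouble_injective : Function.Injective (residueDouble m) := by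
  refine (injective_iff_map_eq_zero _).2 fun x hx => ?_
  obtain ⟨k, rfl⟩ := ZMod.intCast_surjective x
  rw [residueDouble_intCast] at hx
  -- The factor `2` is not invertible modulo `2 * m`; it is cancelled in a divisibility of integers.
  have h : ((2 * k : ℤ) : ZMod (2 * m)) = 0 := by push_cast; exact hx
  rw [ZMod.intCast_zmod_eq_zero_iff_dvd] at *
  push_cast at h
  exact Int.dvd_of_mul_dvd_mul_left (by norm_num) h

theorem internal_mul (d e : CyclicPartition m n) : (d * e).internal =
    d.internal + e.internal + (internalCount d.skeleton e.skeleton : ZMod m) := rfl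

/-- The homomorphism that replaces every planar partition by the matching of the boundary points of
a neighbourhood of its blocks. -/
noncomputable def doubling (m n : ℕ) : PPa m n →* TL (2 * m) (2 * n) where
  toFun d := ⟨⟨pairing (next d.1.skeleton),
    -- An internal component has two boundary curves. The term `blocks - n` turns the loop count
    -- into an additive rule and vanishes on the identity.
    residueDouble m d.1.internal + (((blocks d.1.skeleton : ℤ) - n : ℤ) : ZMod (2 * m))⟩,
    IsPlanar.pairing d.2, pairing_isMatching _⟩
  map_one' := by
    refine Subtype.ext (CyclicPartition.ext pairing_next_idPart ?_)
    change residueDouble m 0 + (((blocks (idPart (Fin n)) : ℤ) - n : ℤ) : ZMod (2 * m)) = 0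
    rw [blocks_idPart]
    simp
  map_mul' d e := by
    have hd : IsPlanar d.1.skeleton := d.2
    have he : IsPlanar e.1.skeleton := e.2
    refine Subtype.ext (CyclicPartition.ext (hd.comp_pairing he).symm ?_)
    have h := congrArg (Int.cast : ℤ → ZMod (2 * m)) (hd.internalCount_pairing he)
    have h' := residueDouble_intCast (m := m) (internalCount d.1.skeleton e.1.skeleton)
    change residueDouble m (d.1.internal + e.1.internal +
        (internalCount d.1.skeleton e.1.skeleton : ZMod m)) +
        (((blocks (comp d.1.skeleton e.1.skeleton) : ℤ) - n : ℤ) : ZMod (2 * m)) =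
      residueDouble m d.1.internal + (((blocks d.1.skeleton : ℤ) - n : ℤ) : ZMod (2 * m)) +
        (residueDouble m e.1.internal + (((blocks e.1.skeleton : ℤ) - n : ℤ) : ZMod (2 * m))) +
        (internalCount (pairing (next d.1.skeleton)) (pairing (next e.1.skeleton)) : ZMod (2 * m))
    rw [map_add, map_add]
    push_cast at h h' ⊢
    rw [h, h']
    ring

theorem doubling_injective : Function.Injective (doubling m n) := by
  intro d e h
  have hs : d.1.skeleton = e.1.skeleton := next_injective (pairing_injective
    (congrArg (fun d : TL (2 * m) (2 * n) => d.1.skeleton) h))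
  have hi : residueDouble m d.1.internal + (((blocks d.1.skeleton : ℤ) - n : ℤ) : ZMod (2 * m)) =
      residueDouble m e.1.internal + (((blocks e.1.skeleton : ℤ) - n : ℤ) : ZMod (2 * m)) :=
    congrArg (fun d : TL (2 * m) (2 * n) => d.1.internal) h
  rw [hs] at hi
  exact Subtype.ext (CyclicPartition.ext hs (residueDouble_injective (add_right_cancel hi)))

theorem TL.o_pow (m n k : ℕ) : (TL.o m n ^ k).1 = ⟨idPart (Fin n), k⟩ := by
  induction k with
  | zero => exact CyclicPartition.ext rfl Nat.cast_zero.symm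
  | succ k ih =>
    rw [pow_succ, Submonoid.coe_mul, ih]
    refine CyclicPartition.ext (idPart_comp _) ?_
    rw [internal_mul]
    simp [TL.o, internalCount_idPart_left]

theorem TL.o_pow_mul (k : ℕ) (d : TL m n) :
    (TL.o m n ^ k * d).1 = ⟨d.1.skeleton, k + d.1.internal⟩ := by
  rw [Submonoid.coe_mul, TL.o_pow]
  refine CyclicPartition.ext (idPart_comp _) ?_
  rw [internal_mul, internalCount_idPart_left]
  simp

end Doubling

end CyclicDiagram

theorem propositionP (m n : ℕ) (hm : 1 ≤ m) :
    ∃ f : CyclicDiagram.PPa m n →* CyclicDiagram.TL (2 * m) (2 * n),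
      Function.Injective f ∧
      (∀ (i : ℕ) (hi : 1 ≤ i ∧ i ≤ n), f (CyclicDiagram.PPa.p m n i) =
        CyclicDiagram.TL.o (2 * m) (2 * n) *
          CyclicDiagram.TL.u (2 * m) (2 * n) (2 * i - 1) (by omega)) ∧
      (∀ (i : ℕ) (hi : 1 ≤ i ∧ i < n), f (CyclicDiagram.PPa.pHalf m n i) =
        CyclicDiagram.TL.o (2 * m) (2 * n) ^ (2 * m - 1) *
          CyclicDiagram.TL.u (2 * m) (2 * n) (2 * i) (by omega)) ∧
      f (CyclicDiagram.PPa.c m n) = CyclicDiagram.TL.o (2 * m) (2 * n) ^ 2 := by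
  open CyclicDiagram in
  refine ⟨doubling m n, doubling_injective, fun i hi => Subtype.ext ?_,
    fun i hi => Subtype.ext ?_, Subtype.ext ?_⟩
  · rw [← pow_one (TL.o (2 * m) (2 * n)), TL.o_pow_mul]
    refine CyclicPartition.ext (pairing_next_stopPart hi) ?_
    change residueDouble m 0 + (((blocks (stopPart n i) : ℤ) - n : ℤ) : ZMod (2 * m)) =
      ((1 : ℕ) : ZMod (2 * m)) + 0
    rw [blocks_stopPart hi]
    simp
  · rw [TL.o_pow_mul]
    refine CyclicPartition.ext (pairing_next_bridgePart hi) ?_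
    change residueDouble m 0 + (((blocks (bridgePart n i) : ℤ) - n : ℤ) : ZMod (2 * m)) =
      ((2 * m - 1 : ℕ) : ZMod (2 * m)) + 0
    have h : (blocks (bridgePart n i) : ℤ) - n = -1 := by
      have := blocks_bridgePart hi
      omega
    -- The bridge has one block fewer than the identity; the exponent `2 * m - 1` is `-1` modulo `2
    -- * m`.
    rw [h, Nat.cast_pred (by omega), ZMod.natCast_self]
    simp
  · rw [TL.o_pow]
    refine CyclicPartition.ext pairing_next_idPart ?_
    change residueDouble m 1 + (((blocks (idPart (Fin n)) : ℤ) - n : ℤ) : ZMod (2 * m)) =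
      ((2 : ℕ) : ZMod (2 * m))
    have := residueDouble_intCast (m := m) 1
    rw [blocks_idPart]
    simpa using this
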